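/- Fix a field $k$ and integers $n,c\ge 0$. **The category $\mathrm{CM}(n,c)$.** Its objects are pairs $(\mathbb N^r,\mathbf a)$ with $r\ge 0$ and $\mathbf a=(\mathbf a_1,\dots,\mathbf a_n)$ an $n$-tuple of elements of $\mathbb N^r$ such that none of the monomials $x^{\mathbf a_1},\dots,x^{\mathbf a_n}$ divides another one, and such that the quotient $k[x_1,\dots,x_r]/(x^{\mathbf a_1},\dots,x^{\mathbf a_n})$ is a nonzero Cohen–Macaulay ring of codimension $c$ (that is, the ideal has height $c$). A morphism $(\mathbb N^s,\mathbf b)\to(\mathbb N^r,\mathbf a)$ is a semigroup homomorphism $\phi:\mathbb N^s\to\mathbb N^r$ with $\phi(\mathbf b_i)=\mathbf a_i$ for all $i$. An object $(\mathbb N^r,\mathbf a)$ of $\mathrm{CM}(n,c)$ is *maximal* if every morphism $\phi:(\mathbb N^s,\mathbf b)\to(\mathbb N^r,\mathbf a)$ in $\mathrm{CM}(n,c)$ is surjective as a map $\mathbb N^s\to\mathbb N^r$ and has a splitting, i.e. a morphism $\psi:(\mathbb N^r,\mathbf a)\to(\mathbb N^s,\mathbf b)$ with $\phi\circ\psi=\mathrm{id}$.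 **Families.** For an object with square free monomials put $V_p=\{\,i\in[n] : x_p \text{ divides } x^{\mathbf a_i}\,\}$ for $p=1,\dots,r$. Let $\mathrm{CM}_*(n,c)$ be the full subcategory of $\mathrm{CM}(n,c)$ of the objects whose monomials are square free and whose sets $V_1,\dots,V_r$ are distinct; the family associated to such an object is $\{V_1,\dots,V_r\}$. A family of subsets of $[n]$ *corresponds to an object of* $\mathrm{CM}_*(n,c)$ if it is associated to some object of this category. For a family $\mathcal F$ of subsets of $[n]$, its *reduction* $\mathcal F^{\mathrm{red}}$ consists of those members of $\mathcal F$ that are not disjoint unions of other members of $\mathcal F$ (the empty set counts as the union of no sets, so it never lies in $\mathcal F^{\mathrm{red}}$), and $\mathcal F$ is *reduced* if $\mathcal F^{\mathrm{red}}=\mathcal F$. The *refinement order* is defined by $\mathcal F\succ\mathcal G$ iff every member of $\mathcal G$ is a disjoint union of members of $\mathcal F$ (with $\mathcal F\succ\mathcal F$ allowed). **Proposition.** (a) If $\mathcal F$ corresponds to an object of $\mathrm{CM}_*(n,c)$, then so does $\mathcal F^{\mathrm{red}}$. (b) An object of $\mathrm{CM}_*(n,c)$ with associated family $\mathcal F$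 is maximal if and only if $\mathcal F$ is reduced and is maximal, for the refinement order, among the reduced families corresponding to objects of $\mathrm{CM}_*(n,c)$; the latter means that every reduced family $\mathcal G$ corresponding to an object of $\mathrm{CM}_*(n,c)$ with $\mathcal G\succ\mathcal F$ equals $\mathcal F$. -/

import Mathlib

open CategoryTheory

universe u

/-- A Noetherian local ring is Cohen-Macaulay if its depth equals its Krull dimension, i.e. its
maximal ideal contains a regular sequence whose length is the dimension of the ring. -/
def IsCohenMacaulayLocal (R : Type u) [CommRing R] [IsLocalRing R] : Prop :=
  ∃ rs : List R, (∀ x ∈ rs, x ∈ IsLocalRing.maximalIdeal R) ∧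
    RingTheory.Sequence.IsRegular R rs ∧ (rs.length : WithBot ℕ∞) = ringKrullDim R

/-- A ring is Cohen-Macaulay if it is Noetherian and all its localizations at primes are
Cohen-Macaulay local rings. -/
def IsCohenMacaulay (R : Type u) [CommRing R] : Prop :=
  IsNoetherianRing R ∧
    ∀ (p : Ideal R) [p.IsPrime], IsCohenMacaulayLocal (Localization.AtPrime p)

/-- An object of the category `Mon(n)`: a free commutative semigroup `ℕ^r` and an `n`-tuple of
elements of it, the exponents of monomials none of which divides any other. -/
structure MonomialTuple (n : ℕ) where
  /-- the number of variables -/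
  r : ℕ
  /-- the exponent vectors of the monomials -/
  exps : Fin n → (Fin r →₀ ℕ)
  /-- no monomial divides another one -/
  not_dvd : ∀ i j, i ≠ j → ¬ exps i ≤ exps j

namespace MonomialTuple

variable {n : ℕ}

/-- A morphism of `Mon(n)`: a semigroup homomorphism that maps one tuple to the other. (A semigroup
homomorphism into the cancellative `ℕ^s` preserves zero, so it is an additive monoid
homomorphism.) -/
@[ext]
structure Hom (A B : MonomialTuple n) where
  /-- the semigroup homomorphism -/
  toAddMonoidHom : (Fin A.r →₀ ℕ) →+ (Fin B.r →₀ ℕ)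
  map_exps : ∀ i, toAddMonoidHom (A.exps i) = B.exps i

noncomputable instance : Category (MonomialTuple n) where
  Hom := Hom
  id A := ⟨AddMonoidHom.id _, fun _ => rfl⟩
  comp f g := ⟨g.toAddMonoidHom.comp f.toAddMonoidHom, fun i => by
    simp [f.map_exps, g.map_exps]⟩

/-- The monomial ideal generated by the tuple in `k[x_1, …, x_r]`. -/
noncomputable def ideal (k : Type u) [Field k] (A : MonomialTuple n) :
    Ideal (MvPolynomial (Fin A.r) k) :=
  Ideal.span (Set.range fun i => MvPolynomial.monomial (A.exps i) (1 : k))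

/-- The objects of the full subcategory `CM(n,c)` of `Mon(n)`: the quotient of the polynomial ring
over `k` by the monomial ideal is Cohen-Macaulay, and the ideal has codimension (height) `c`. The
unit ideal has height `⊤`, so it is never included. -/
def cm (k : Type u) [Field k] (n c : ℕ) : ObjectProperty (MonomialTuple n) := fun A =>
  IsCohenMacaulay (MvPolynomial (Fin A.r) k ⧸ A.ideal k) ∧ (A.ideal k).height = (c : ℕ∞)

/-- The set of positions `i` such that the variable `x_p` divides the `i`-th monomial. -/
def varSet (A : MonomialTuple n) (p : Fin A.r) : Set (Fin n) := {i | A.exps i p ≠ 0}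

/-- The family of subsets of `[n]` associated to the variables. -/
def family (A : MonomialTuple n) : Set (Set (Fin n)) := Set.range A.varSet

/-- The objects of the full subcategory `CM_*(n,c)` of `CM(n,c)`: the monomials are square free and
the subsets of `[n]` associated to the variables are distinct. -/
def cmStar (k : Type u) [Field k] (n c : ℕ) : ObjectProperty (MonomialTuple n) := fun A =>
  cm k n c A ∧ (∀ i p, A.exps i p ≤ 1) ∧ Function.Injective A.varSet

/-- An object `A` of `CM(n,c)` is maximal if every morphism `φ : B ⟶ A` in `CM(n,c)` is surjective
on semigroups and has a splitting `ψ : A ⟶ B`, with `φ ∘ ψ` the identity. -/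
def IsMaximalObject (k : Type u) [Field k] (c : ℕ) (A : MonomialTuple n) : Prop :=
  cm k n c A ∧ ∀ B : MonomialTuple n, cm k n c B → ∀ φ : B ⟶ A,
    Function.Surjective φ.toAddMonoidHom ∧ ∃ ψ : A ⟶ B, ψ ≫ φ = 𝟙 A

end MonomialTuple

namespace SetFamily

variable {α : Type*}

/-- `S` is a disjoint union of members of `G`. The empty set is the union of no members. -/
def IsDisjointUnion (G : Set (Set α)) (S : Set α) : Prop :=
  ∃ H ⊆ G, H.PairwiseDisjoint id ∧ ⋃₀ H = S

/-- The reduction of a family: discard the members that are disjoint unions of other members. -/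
def reduction (F : Set (Set α)) : Set (Set α) :=
  {S ∈ F | ¬ IsDisjointUnion (F \ {S}) S}

/-- A family is reduced if it is its own reduction. -/
def IsReduced (F : Set (Set α)) : Prop := reduction F = F

/-- The refinement order `F ≽ G`: the family `F` consists of refinements of the members of `G`,
together with additional sets; that is, every member of `G` is a disjoint union of members
of `F`. -/
def Refines (F G : Set (Set α)) : Prop := ∀ S ∈ G, IsDisjointUnion F S

end SetFamily

/-- The family `F` of subsets of `[n]` corresponds to an object of `CM_*(n,c)`. -/
def IsAssociatedFamily (k : Type u) [Field k] (n c : ℕ) (F : Set (Set (Fin n))) : Prop :=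
  ∃ A : MonomialTuple n, MonomialTuple.cmStar k n c A ∧ A.family = F

/-! Write a morphism `B ⟶ A` as a matrix of natural numbers. If `A` is square free, the variables of
`B` with a nonzero entry at `p` have pairwise disjoint sets with union `V_p`, so the family of `B`
refines that of `A` (`Hom.refines`). Conversely, for square free tuples with distinct sets upstairs,
the indicators of the decompositions form the matrix of a morphism (`nonempty_hom_of_refines`).

For (a), set equal to one all variables outside the reduction. Every `V_p` is still a union of
remaining sets, so no divisibility is created (`isAssociatedFamily_reduction`).

In (b), if `A` is maximal, any refining object maps to `A` and this map splits. A splitting puts the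
family of `A` inside the other family and makes it refine that family; apply this to the reduction
and to reduced families `G`. Conversely, maximality of the family makes it refine the family of
every square free object over `A`. For an arbitrary `f : B ⟶ A`, the variables that `f` does not
kill have exponents at most one, and the killed ones can be set to one. A killed variable `q` may
have large exponents, but polarization turns each level set `{i | j ≤ b_i(q)}` into the set of a
square free variable. Summing over `j` expresses the exponents of `q` linearly in those of `A`.
Reducedness picks out a variable of `B` over each variable of `A`, and these data assemble to a
splitting (`exists_splitting`).

The algebra behind this is that setting variables to one and polarizing preserve the Cohen-Macaulay
property and the codimension. The first operation is a localization followed by descent from a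
polynomial ring, the second is undone by dividing by a nonzerodivisor; in both cases it is enough to
look at the origin (`IsCohenMacaulayAtOrigin.isCohenMacaulayLocal`). Codimension is counted by
vertex covers, and unmixedness keeps it fixed when variables become one. -/

section CommutativeAlgebra

open IsLocalRing RingTheory.Sequence Pointwise

/-- The maximal ideal of `R` contains an `M`-regular sequence of length `d`. -/
def HasRegularSequence (R : Type u) [CommRing R] [IsLocalRing R] (M : Type u) [AddCommGroup M]
    [Module R M] (d : ℕ) : Prop :=
  ∃ rs : List R, rs.length = d ∧ (∀ r ∈ rs, r ∈ maximalIdeal R) ∧ IsRegular M rs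

/-! ### Regular sequences, depth and associated primes. -/

section RegularSequences

variable {R : Type u} [CommRing R] [IsLocalRing R]
variable {M : Type u} [AddCommGroup M] [Module R M]

lemma HasRegularSequence.nontrivial {d : ℕ} (h : HasRegularSequence R M d) : Nontrivial M := by
  obtain ⟨rs, -, -, hr⟩ := h
  exact hr.nontrivial

lemma hasRegularSequence_zero [Nontrivial M] : HasRegularSequence R M 0 :=
  ⟨[], rfl, by simp, IsRegular.nil R M⟩

lemma HasRegularSequence.cons {x : R} {d : ℕ} (hx : x ∈ maximalIdeal R) (reg : IsSMulRegular M x)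
    (h : HasRegularSequence R (QuotSMulTop x M) d) : HasRegularSequence R M (d + 1) := by
  obtain ⟨rs, hl, hm, hr⟩ := h
  exact ⟨x :: rs, by simp [hl], by simpa using ⟨hx, hm⟩, (isRegular_cons_iff M x rs).mpr ⟨reg, hr⟩⟩

lemma HasRegularSequence.exists_cons {d : ℕ} (h : HasRegularSequence R M (d + 1)) :
    ∃ x ∈ maximalIdeal R, IsSMulRegular M x ∧ HasRegularSequence R (QuotSMulTop x M) d := by
  obtain ⟨rs, hl, hm, hr⟩ := h
  match rs with
  | [] => simp at hl
  | x :: rs =>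
    rw [isRegular_cons_iff] at hr
    simp only [List.mem_cons, forall_eq_or_imp] at hm
    exact ⟨x, hm.1, hr.1, rs, by simpa using hl, hm.2, hr.2⟩

lemma maximalIdeal_smul_top_lt_top [Module.Finite R M] [Nontrivial M] :
    maximalIdeal R • (⊤ : Submodule R M) < ⊤ :=
  (Submodule.top_ne_ideal_smul_of_le_jacobson_annihilator
    (IsLocalRing.maximalIdeal_le_jacobson _)).symm.lt_top

/-- The depth drops by exactly one modulo a nonzerodivisor. -/
lemma HasRegularSequence.quotSMulTop [IsNoetherianRing R] [Module.Finite R M] {x : R} {d : ℕ}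
    (hx : x ∈ maximalIdeal R) (reg : IsSMulRegular M x) (h : HasRegularSequence R M (d + 1)) :
    HasRegularSequence R (QuotSMulTop x M) d := by
  have := h.nontrivial
  have := nontrivial_quotSMulTop_of_mem_maximalIdeal M hx
  -- Depth is detected by vanishing of Ext, and the long exact sequence of multiplication by `x`
  -- traps the group of `M ⧸ xM` in degree `i` between those of `M` in degrees `i` and `i + 1`.
  have h1 := ((ModuleCat.exists_isRegular_tfae (maximalIdeal R) (d + 1) (ModuleCat.of R M)
    maximalIdeal_smul_top_lt_top).out 3 1).mp h
  refine ((ModuleCat.exists_isRegular_tfae (maximalIdeal R) d (ModuleCat.of R (QuotSMulTop x M))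
    maximalIdeal_smul_top_lt_top).out 1 3).mp ?_
  intro i hi
  have zero1 := AddCommGrpCat.isZero_of_iff_subsingleton.mpr (h1 i (by omega))
  have zero2 := AddCommGrpCat.isZero_of_iff_subsingleton.mpr (h1 (i + 1) (by omega))
  exact AddCommGrpCat.subsingleton_of_isZero <| ShortComplex.Exact.isZero_of_both_zeros
    ((Abelian.Ext.covariant_sequence_exact₃' _
      (IsSMulRegular.smulShortComplex_shortExact (M := ModuleCat.of R M) reg)) i (i + 1) rfl)
    (zero1.eq_zero_of_src _) (zero2.eq_zero_of_tgt _)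

lemma ringKrullDim_quotient_add_one_le_of_lt {A : Type u} [CommRing A] {P Q : Ideal A} [P.IsPrime]
    (h : P < Q) : ringKrullDim (A ⧸ Q) + 1 ≤ ringKrullDim (A ⧸ P) := by
  obtain ⟨x, hxQ, hxP⟩ := SetLike.exists_of_lt h
  refine ringKrullDim_succ_le_of_surjective (Ideal.Quotient.factor h.le)
    (Ideal.Quotient.factor_surjective h.le) (r := Ideal.Quotient.mk P x) ?_ ?_
  · rw [mem_nonZeroDivisors_iff_ne_zero]
    rwa [Ne, Ideal.Quotient.eq_zero_iff_mem]
  · simpa [Ideal.Quotient.eq_zero_iff_mem] using hxQ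

/-- An associated prime of `M` lies in an associated prime of `M ⧸ xM` that contains `x`. -/
lemma exists_associatedPrime_quotSMulTop [IsNoetherianRing R] [Module.Finite R M] {x : R}
    (hx : x ∈ maximalIdeal R) (reg : IsSMulRegular M x) {P : Ideal R}
    (hP : P ∈ associatedPrimes R M) :
    ∃ Q ∈ associatedPrimes R (QuotSMulTop x M), P < Q := by
  obtain ⟨hPp, z, hz⟩ := isAssociatedPrime_iff.mp (AssociatedPrimes.mem_iff.mp hP)
  have hz0 : z ≠ 0 := by
    rintro rfl
    exact hPp.ne_top (by simp [hz])
  let N : Submodule R M := Submodule.torsionBySet R M P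
  have hN (w : M) : w ∈ N ↔ ∀ r ∈ P, r • w = 0 := by
    simp [N, Submodule.mem_torsionBySet_iff]
  -- Nakayama: if `x • v` is killed by `P` then so is `v`, since `x` is regular; hence `N ≤ xM`
  -- would give `N = xN` and `N = 0`, although `z ∈ N`.
  have hNx : ¬ N ≤ x • (⊤ : Submodule R M) := by
    intro hle
    have h1 : N ≤ maximalIdeal R • N := by
      intro w hw
      obtain ⟨v, -, rfl⟩ := (Submodule.mem_smul_pointwise_iff_exists _ _ _).mp (hle hw)
      refine Submodule.smul_mem_smul hx ((hN v).mpr fun r hr => reg ?_)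
      have h0 := (hN _).mp hw r hr
      rw [smul_comm] at h0
      simpa using h0
    have h2 : N = ⊥ := Submodule.eq_bot_of_le_smul_of_le_jacobson_bot _ N
      (IsNoetherian.noetherian N) h1 (maximalIdeal_le_jacobson _)
    have h3 : z ∈ N := by
      rw [hN]
      intro r hr
      rw [hz] at hr
      simpa [Submodule.mem_colon_singleton] using hr
    rw [h2] at h3
    exact hz0 (by simpa using h3)
  obtain ⟨w, hw, hwx⟩ := SetLike.not_le_iff_exists.mp hNx
  obtain ⟨Q, hQ, hle⟩ := exists_le_isAssociatedPrime_of_isNoetherianRing R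
    (Submodule.Quotient.mk w : QuotSMulTop x M)
    (by rwa [Ne, Submodule.Quotient.mk_eq_zero])
  have hxQ : x ∈ Q := hle (by
    rw [Submodule.mem_colon_singleton, ← Submodule.Quotient.mk_smul, Submodule.mem_bot,
      Submodule.Quotient.mk_eq_zero]
    exact Submodule.smul_mem_pointwise_smul _ _ _ trivial)
  refine ⟨Q, hQ, lt_of_le_of_ne (fun r hr => hle ?_) ?_⟩
  · rw [Submodule.mem_colon_singleton, ← Submodule.Quotient.mk_smul, (hN w).mp hw r hr]
    simp
  · rintro rfl
    rw [hz, Submodule.mem_colon_singleton, Submodule.mem_bot] at hxQ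
    exact hz0 (reg (by simpa using hxQ))

/-- The depth of a module is at most the dimension of each of its associated primes. -/
lemma HasRegularSequence.le_ringKrullDim_quotient [IsNoetherianRing R] {d : ℕ} :
    ∀ {M : Type u} [AddCommGroup M] [Module R M] [Module.Finite R M] {P : Ideal R},
      HasRegularSequence R M d → P ∈ associatedPrimes R M →
      (d : WithBot ℕ∞) ≤ ringKrullDim (R ⧸ P) := by
  induction d with
  | zero =>
    intro M _ _ _ P _ hP
    have := hP.isPrime
    exact ringKrullDim_nonneg_of_nontrivial
  | succ d ih =>
    intro M _ _ _ P h hP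
    obtain ⟨x, hx, reg, h'⟩ := h.exists_cons
    obtain ⟨Q, hQ, hlt⟩ := exists_associatedPrime_quotSMulTop hx reg hP
    have := hP.isPrime
    refine le_trans ?_ (ringKrullDim_quotient_add_one_le_of_lt hlt)
    push_cast
    gcongr
    exact ih h' hQ

omit [IsLocalRing R] in
lemma IsBaseChange.quotSMulTop {S N : Type u} [CommRing S] [Algebra R S] [AddCommGroup N]
    [Module R N] [Module S N] [IsScalarTower R S N] {f : M →ₗ[R] N} (hf : IsBaseChange S f)
    (x : R) : ∃ g : QuotSMulTop x M →ₗ[R] QuotSMulTop (algebraMap R S x) N, IsBaseChange S g := by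
  have e := (QuotSMulTop.algebraMapTensorEquivTensorQuotSMulTop x M S).symm ≪≫ₗ
    QuotSMulTop.congr ((algebraMap R S) x) hf.equiv
  exact ⟨e.toLinearMap.restrictScalars R ∘ₗ TensorProduct.mk R S (QuotSMulTop x M) 1,
    IsBaseChange.of_equiv e (fun _ ↦ by simp)⟩

/-- Depth descends along flat local homomorphisms whose closed fibre is a field. -/
lemma HasRegularSequence.of_flat [IsNoetherianRing R] {S : Type u} [CommRing S] [IsLocalRing S]
    [IsNoetherianRing S] [Algebra R S] [Module.Flat R S]
    (hmS : (maximalIdeal R).map (algebraMap R S) = maximalIdeal S) {d : ℕ} :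
    ∀ {M N : Type u} [AddCommGroup M] [Module R M] [Module.Finite R M] [AddCommGroup N]
      [Module R N] [Module S N] [IsScalarTower R S N] (f : M →ₗ[R] N) (_ : IsBaseChange S f),
      HasRegularSequence S N d → HasRegularSequence R M d := by
  have : IsLocalHom (algebraMap R S) := by
    rw [((IsLocalRing.local_hom_TFAE (algebraMap R S)).out 0 2 :)]
    exact hmS.le
  have : Module.FaithfullyFlat R S := Module.FaithfullyFlat.of_flat_of_isLocalHom
  induction d with
  | zero =>
    intro M N _ _ _ _ _ _ _ f hf h
    have := h.nontrivial
    have : Nontrivial M := by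
      by_contra! hM
      have : Subsingleton N := hf.equiv.symm.injective.subsingleton
      exact not_subsingleton N this
    exact hasRegularSequence_zero
  | succ d ih =>
    intro M N _ _ _ _ _ _ _ f hf h
    have hfin : Module.Finite S N := Module.Finite.equiv hf.equiv
    have hinj : Function.Injective f := by
      have h1 := Module.FaithfullyFlat.tensorProduct_mk_injective (A := R) (B := S) M
      have h2 : (f : M → N) = hf.equiv ∘ (fun m => (1 : S) ⊗ₜ[R] m) := by
        ext m; simp
      rw [h2]
      exact hf.equiv.injective.comp h1
    -- Otherwise prime avoidance gives a nonzero `z` killed by the maximal ideal of `R`. Then `f z`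
    -- is nonzero and killed by the maximal ideal of `S`, which contains a regular element of `N`.
    obtain ⟨x, hx, reg⟩ : ∃ x ∈ maximalIdeal R, IsSMulRegular M x := by
      by_contra! hcon
      have h1 : (maximalIdeal R : Set R) ⊆ ⋃ p ∈ associatedPrimes R M, (p : Set R) := by
        rw [biUnion_associatedPrimes_eq_compl_regular]
        exact fun x hx => hcon x hx
      have h2 : ∃ P ∈ associatedPrimes R M, maximalIdeal R ≤ P :=
        (Ideal.subset_union_prime_finite (associatedPrimes.finite R M) ⊥ ⊥
          (fun P hP _ _ => hP.isPrime)).mp h1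
      obtain ⟨P, hP, hle⟩ := h2
      obtain ⟨hPp, z, hz⟩ := isAssociatedPrime_iff.mp (AssociatedPrimes.mem_iff.mp hP)
      have hz0 : z ≠ 0 := by
        rintro rfl
        exact hPp.ne_top (by simp [hz])
      obtain ⟨y, hy, regy, -⟩ := h.exists_cons
      have h3 : ∀ s ∈ maximalIdeal S, s • f z = 0 := by
        rw [← hmS]
        intro s hs
        have : (maximalIdeal R).map (algebraMap R S) ≤ Submodule.colon ⊥ {f z} := by
          rw [Ideal.map_le_iff_le_comap]
          intro r hr
          have := hle hr
          rw [hz, Submodule.mem_colon_singleton, Submodule.mem_bot] at this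
          rw [Ideal.mem_comap, Submodule.mem_colon_singleton, algebraMap_smul, ← map_smul, this]
          simp
        simpa [Submodule.mem_colon_singleton] using this hs
      have h4 : f z = 0 := regy (by simpa using h3 y hy)
      exact hz0 (hinj (by simpa using h4))
    have hxS : algebraMap R S x ∈ maximalIdeal S := by
      rw [← hmS]; exact Ideal.mem_map_of_mem _ hx
    have regS : IsSMulRegular N (algebraMap R S x) := reg.of_flat_of_isBaseChange hf
    obtain ⟨g, hg⟩ := hf.quotSMulTop x
    exact (ih g hg (h.quotSMulTop hxS regS)).cons hx reg

end RegularSequences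

/-! ### Localization of Cohen-Macaulay modules. -/

section Localization

variable {R : Type u} [CommRing R]

lemma algebraMap_mem_annihilator_of_isBaseChange {S M N : Type u} [CommRing S] [Algebra R S]
    [AddCommGroup M] [Module R M] [AddCommGroup N] [Module R N] [Module S N] [IsScalarTower R S N]
    {f : M →ₗ[R] N} (hf : IsBaseChange S f) {r : R} (hr : r ∈ Module.annihilator R M) :
    algebraMap R S r ∈ Module.annihilator S N := by
  rw [Module.mem_annihilator] at hr ⊢
  intro z
  induction z using hf.inductionOn with
  | zero => simp
  | tmul m => rw [algebraMap_smul, ← map_smul, hr, map_zero]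
  | smul s z hz => rw [smul_comm, hz, smul_zero]
  | add a b ha hb => rw [smul_add, ha, hb, add_zero]

/-- If a prime `P` consists of zero divisors on a Cohen-Macaulay module, then `P` is the only prime
of the support inside `P`. -/
lemma supportDim_le_zero_of_forall_not_isSMulRegular [IsLocalRing R] [IsNoetherianRing R]
    (P : Ideal R) [P.IsPrime] {S : Type u} [CommRing S] [Algebra R S] [IsLocalization.AtPrime S P]
    {n : ℕ} {M N : Type u} [AddCommGroup M] [Module R M] [Module.Finite R M] [AddCommGroup N]
    [Module R N] [Module S N] [IsScalarTower R S N] {f : M →ₗ[R] N} (hf : IsBaseChange S f)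
    (h : HasRegularSequence R M n) (hdim : Module.supportDim R M ≤ n)
    (hreg : ∀ x ∈ P, ¬ IsSMulRegular M x) : Module.supportDim S N ≤ 0 := by
  have hfin : Module.Finite S N := Module.Finite.equiv hf.equiv
  obtain ⟨P', hP', hle⟩ : ∃ P' ∈ associatedPrimes R M, P ≤ P' := by
    refine (Ideal.subset_union_prime_finite (associatedPrimes.finite R M) ⊥ ⊥
      (fun P hP _ _ => hP.isPrime)).mp ?_
    rw [biUnion_associatedPrimes_eq_compl_regular]
    exact fun x hx => hreg x hx
  have hP'p := hP'.isPrime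
  have h1 := h.le_ringKrullDim_quotient hP'
  -- The contraction `q` of `Q` satisfies `q ≤ P ≤ P'`, with `R ⧸ P'` of dimension at least `n` and
  -- `R ⧸ q` of dimension at most `n`. A strict inclusion would lower the dimension, so `q = P`.
  have key : ∀ Q ∈ Module.support S N, Q.asIdeal = P.map (algebraMap R S) := by
    intro Q hQ
    rw [Module.mem_support_iff_of_finite] at hQ
    have hq : Module.annihilator R M ≤ Q.asIdeal.comap (algebraMap R S) :=
      fun r hr => hQ (algebraMap_mem_annihilator_of_isBaseChange hf hr)
    have hqP : Q.asIdeal.comap (algebraMap R S) ≤ P := by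
      have hd := (IsLocalization.isPrime_iff_isPrime_disjoint P.primeCompl S Q.asIdeal).mp Q.2
      intro x hx
      by_contra hxP
      exact Set.disjoint_left.mp hd.2 hxP hx
    have h2 : ringKrullDim (R ⧸ Q.asIdeal.comap (algebraMap R S)) ≤ n := by
      refine le_trans ?_ hdim
      rw [Module.supportDim_eq_ringKrullDim_quotient_annihilator]
      exact ringKrullDim_le_of_surjective (Ideal.Quotient.factor hq)
        (Ideal.Quotient.factor_surjective hq)
    have h3 : Q.asIdeal.comap (algebraMap R S) = P := by
      refine le_antisymm hqP ?_
      by_contra hlt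
      have h4 := ringKrullDim_quotient_add_one_le_of_lt
        (lt_of_le_not_ge (hqP.trans hle) fun hge => hlt (hle.trans hge))
      have h5 : ((n + 1 : ℕ) : WithBot ℕ∞) ≤ (n : ℕ) := by
        refine le_trans ?_ (h4.trans h2)
        push_cast
        gcongr
      have h6 : n + 1 ≤ n := by exact_mod_cast h5
      omega
    rw [← h3]
    exact (IsLocalization.map_under P.primeCompl S Q.asIdeal).symm
  have : Subsingleton (Module.support S N) :=
    ⟨fun a b => Subtype.ext (PrimeSpectrum.ext ((key a a.2).trans (key b b.2).symm))⟩
  exact Order.krullDim_nonpos_of_subsingleton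

/-- Localizations of Cohen-Macaulay modules are Cohen-Macaulay. -/
lemma HasRegularSequence.exists_localization [IsLocalRing R] [IsNoetherianRing R] (P : Ideal R)
    [P.IsPrime] (S : Type u) [CommRing S] [Algebra R S] [IsLocalization.AtPrime S P] [IsLocalRing S]
    (n : ℕ) :
    ∀ {M N : Type u} [AddCommGroup M] [Module R M] [Module.Finite R M] [AddCommGroup N]
      [Module R N] [Module S N] [IsScalarTower R S N] (f : M →ₗ[R] N) (_ : IsBaseChange S f)
      [Nontrivial N], HasRegularSequence R M n → Module.supportDim R M ≤ n →
      ∃ e : ℕ, HasRegularSequence S N e ∧ Module.supportDim S N ≤ e := by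
  have : IsNoetherianRing S := IsLocalization.isNoetherianRing P.primeCompl S inferInstance
  have : Module.Flat R S := IsLocalization.flat S P.primeCompl
  have hPm : P ≤ maximalIdeal R := le_maximalIdeal (Ideal.IsPrime.ne_top ‹_›)
  have hmem (x : R) (hx : x ∈ P) : algebraMap R S x ∈ maximalIdeal S :=
    (IsLocalization.AtPrime.to_map_mem_maximal_iff S P x).mpr hx
  induction n using Nat.strong_induction_on with
  | _ n ih =>
  intro M N _ _ _ _ _ _ _ f hf _ h hdim
  have hfin : Module.Finite S N := Module.Finite.equiv hf.equiv
  -- A regular element of `P` can be divided out on both sides. If there is none, the localized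
  -- module has dimension at most zero and the empty sequence suffices.
  by_cases hreg : ∃ x ∈ P, IsSMulRegular M x
  · obtain ⟨x, hxP, reg⟩ := hreg
    have hMnt := h.nontrivial
    have hd := Module.supportDim_quotSMulTop_succ_eq_supportDim reg (hPm hxP)
    have hnt := nontrivial_quotSMulTop_of_mem_maximalIdeal M (hPm hxP)
    have regS : IsSMulRegular N (algebraMap R S x) := reg.of_flat_of_isBaseChange hf
    have hntS := nontrivial_quotSMulTop_of_mem_maximalIdeal N (hmem x hxP)
    rw [← hd] at hdim
    obtain _ | k := n
    · exfalso
      have h0 : 0 ≤ Module.supportDim R (QuotSMulTop x M) := by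
        obtain ⟨p⟩ := (Module.nonempty_support_of_nontrivial
          (R := R) (M := QuotSMulTop x M)).to_subtype
        have : Nonempty (Module.support R (QuotSMulTop x M)) := ⟨p⟩
        exact Order.krullDim_nonneg
      have h1 : (0 : WithBot ℕ∞) + 1 ≤ 0 := le_trans (by gcongr) hdim
      exact absurd h1 (by decide)
    · obtain ⟨g, hg⟩ := hf.quotSMulTop x
      obtain ⟨e, he, hde⟩ := ih k (by omega) g hg (h.quotSMulTop (hPm hxP) reg) (by
        push_cast at hdim
        exact ENat.WithBot.add_le_add_one_right_iff.mp hdim)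
      refine ⟨e + 1, he.cons (hmem x hxP) regS, ?_⟩
      rw [← Module.supportDim_quotSMulTop_succ_eq_supportDim regS (hmem x hxP)]
      push_cast
      gcongr
  · push Not at hreg
    exact ⟨0, hasRegularSequence_zero,
      supportDim_le_zero_of_forall_not_isSMulRegular P hf h hdim hreg⟩

end Localization

/-! ### Cohen-Macaulay local rings. -/

section CohenMacaulayLocal

/-- Only one inequality has to be checked: a regular sequence lowers the dimension by its length,
and the nonzero quotient still has dimension at least zero. -/
lemma isCohenMacaulayLocal_iff {R : Type u} [CommRing R] [IsLocalRing R] [IsNoetherianRing R] :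
    IsCohenMacaulayLocal R ↔ ∃ d : ℕ, HasRegularSequence R R d ∧ ringKrullDim R ≤ d := by
  constructor
  · rintro ⟨rs, hm, hr, hd⟩
    exact ⟨rs.length, ⟨rs, rfl, hm, hr⟩, hd.ge⟩
  · rintro ⟨d, ⟨rs, rfl, hm, hr⟩, hd⟩
    refine ⟨rs, hm, hr, le_antisymm ?_ hd⟩
    rw [← ringKrullDim_add_length_eq_ringKrullDim_of_isRegular rs hr]
    have : Nontrivial (R ⧸ Ideal.ofList rs) := by
      refine Ideal.Quotient.nontrivial_iff.mpr fun h => ?_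
      have := hr.2
      simp [h] at this
    calc (rs.length : WithBot ℕ∞) = 0 + rs.length := by simp
      _ ≤ _ := by gcongr; exact ringKrullDim_nonneg_of_nontrivial

lemma IsCohenMacaulayLocal.of_ringEquiv {R S : Type u} [CommRing R] [IsLocalRing R] [CommRing S]
    [IsLocalRing S] (e : R ≃+* S) (h : IsCohenMacaulayLocal R) : IsCohenMacaulayLocal S := by
  obtain ⟨rs, hm, hr, hd⟩ := h
  refine ⟨rs.map e, ?_, ?_, ?_⟩
  · intro x hx
    obtain ⟨y, hy, rfl⟩ := List.mem_map.mp hx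
    have := hm y hy
    rw [mem_maximalIdeal, mem_nonunits_iff] at this ⊢
    simpa using this
  · refine (AddEquiv.isRegular_congr (e := e.toAddEquiv) ?_).mp hr
    rw [List.forall₂_map_right_iff, List.forall₂_same]
    intro r _ x
    simp
  · rw [List.length_map, hd, ringKrullDim_eq_of_ringEquiv e]

lemma IsCohenMacaulayLocal.of_isLocalization {R : Type u} [CommRing R] [IsLocalRing R]
    [IsNoetherianRing R] (h : IsCohenMacaulayLocal R) (P : Ideal R) [P.IsPrime]
    (S : Type u) [CommRing S] [Algebra R S] [IsLocalization.AtPrime S P] [IsLocalRing S] :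
    IsCohenMacaulayLocal S := by
  have : IsNoetherianRing S := IsLocalization.isNoetherianRing P.primeCompl S inferInstance
  obtain ⟨d, h1, h2⟩ := isCohenMacaulayLocal_iff.mp h
  obtain ⟨e, h3, h4⟩ := h1.exists_localization P S d (Algebra.linearMap R S)
    (IsBaseChange.linearMap R S) (by rwa [Module.supportDim_self_eq_ringKrullDim])
  rw [Module.supportDim_self_eq_ringKrullDim] at h4
  exact isCohenMacaulayLocal_iff.mpr ⟨e, h3, h4⟩

/-- The Cohen-Macaulay property ascends along quotients by a nonzerodivisor. -/
lemma IsCohenMacaulayLocal.of_surjective {A B : Type u} [CommRing A] [IsLocalRing A]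
    [IsNoetherianRing A] [CommRing B] [IsLocalRing B] (f : A →+* B)
    (hf : Function.Surjective f) {t : A} (ht : t ∈ maximalIdeal A) (reg : IsSMulRegular A t)
    (hker : RingHom.ker f = Ideal.span {t}) (h : IsCohenMacaulayLocal B) :
    IsCohenMacaulayLocal A := by
  obtain ⟨rs, hm, hr, hd⟩ := h
  have e : (A ⧸ Ideal.span {t}) ≃+* B :=
    (Ideal.quotEquivOfEq hker.symm).trans (RingHom.quotientKerEquivOfSurjective hf)
  obtain ⟨ss, rfl⟩ : ∃ ss : List A, ss.map f = rs := by
    have := List.map_surjective_iff.mpr hf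
    exact this rs
  rw [isCohenMacaulayLocal_iff]
  refine ⟨ss.length + 1, HasRegularSequence.cons ht reg ⟨ss, rfl, ?_, ?_⟩, ?_⟩
  · intro s hs
    have := hm (f s) (List.mem_map_of_mem hs)
    rw [mem_maximalIdeal, mem_nonunits_iff] at this ⊢
    exact fun hu => this (hu.map f)
  · have hk : t • (⊤ : Submodule A A) = RingHom.ker f := by
      rw [hker, ← Submodule.ideal_span_singleton_smul]
      simp
    let e' : QuotSMulTop t A ≃+ B := (Submodule.quotEquivOfEq _ _ hk).toAddEquiv.trans
      (RingHom.quotientKerEquivOfSurjective hf).toAddEquiv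
    refine (AddEquiv.isRegular_congr (e := e') (bs := ss.map f) ?_).mpr hr
    rw [List.forall₂_map_right_iff, List.forall₂_same]
    intro s _ x
    obtain ⟨a, rfl⟩ := Submodule.Quotient.mk_surjective _ x
    change f (s * a) = f s * f a
    simp
  · rw [← ringKrullDim_quotient_span_singleton_succ_eq_ringKrullDim reg ht,
      ringKrullDim_eq_of_ringEquiv e, ← hd]
    simp

end CohenMacaulayLocal

/-! ### Ascent to and descent from polynomial rings. -/

section Polynomial

open Polynomial

variable {R : Type u} [CommRing R]

/-- The localization of `R[X]` at a prime `p` is also a localization of `R_q[X]`, where `q` is the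
contraction of `p`. -/
lemma exists_localization_polynomial (p : Ideal R[X]) [p.IsPrime] (q : Ideal R) [q.IsPrime]
    (hq : p.comap C = q) :
    ∃ (p' : Ideal (Localization.AtPrime q)[X]) (_ : p'.IsPrime),
      p'.comap C = maximalIdeal (Localization.AtPrime q) ∧
      p' = p.map (mapRingHom (algebraMap R (Localization.AtPrime q))) ∧
      Nonempty (Localization.AtPrime p' ≃+* Localization.AtPrime p) := by
  subst hq
  let q := p.comap C
  let S := (Localization.AtPrime q)[X]
  let pc := Submonoid.map Polynomial.C.toMonoidHom q.primeCompl
  let : Algebra R[X] S := algebra R (Localization.AtPrime q)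
  have : IsLocalization pc S := Polynomial.isLocalization _ _
  let pS := p.map (algebraMap R[X] S)
  have disj : Disjoint (pc : Set R[X]) (p : Set R[X]) := by
    simpa [pc, q] using! Set.disjoint_image_left.mpr
      (Set.disjoint_compl_left_iff_subset.mpr (fun _ a ↦ a))
  have hpS : pS.IsPrime := IsLocalization.isPrime_of_isPrime_disjoint pc _ _ ‹_› disj
  have : IsLocalization.AtPrime (Localization.AtPrime pS) p := by
    convert IsLocalization.isLocalization_isLocalization_atPrime_isLocalization pc
      (Localization.AtPrime pS) pS
    exact (IsLocalization.under_map_of_isPrime_disjoint pc _ ‹_› disj).symm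
  have eq : Ideal.comap C pS = maximalIdeal (Localization.AtPrime q) := by
    rw [← IsLocalization.map_under q.primeCompl _ (Ideal.comap C pS),
      ← IsLocalization.map_under q.primeCompl _ (maximalIdeal (Localization.AtPrime q))]
    simp only [Ideal.comap_comap, S, pS]
    rw [← Polynomial.algebraMap_eq (R := Localization.AtPrime q),
      ← IsScalarTower.algebraMap_eq R (Localization.AtPrime q) (Localization.AtPrime q)[X],
      IsScalarTower.algebraMap_eq R R[X] (Localization.AtPrime q)[X], ← Ideal.comap_comap,
      ← Ideal.under_def R[X], IsLocalization.under_map_of_isPrime_disjoint pc _ ‹_› disj]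
    simp [q, IsLocalization.AtPrime.under_maximalIdeal (Localization.AtPrime q) q]
  exact ⟨pS, hpS, eq, rfl, ⟨(IsLocalization.algEquiv p.primeCompl
    (Localization.AtPrime pS) (Localization.AtPrime p)).toRingEquiv⟩⟩

/-- Flatness of `R[X]` handles `rs`, and a monic polynomial stays a nonzerodivisor over every
quotient of `R`. -/
lemma Polynomial.isWeaklyRegular_append_monic {rs : List R} (hrs : IsWeaklyRegular R rs)
    {y : R[X]} (hy : y.Monic) : IsWeaklyRegular R[X] (rs.map C ++ [y]) := by
  rw [isWeaklyRegular_append_iff]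
  refine ⟨hrs.of_flat (S := R[X]), ?_⟩
  rw [isWeaklyRegular_singleton_iff, isSMulRegular_quotient_iff_mem_of_smul_mem]
  intro f hf
  have key (g : R[X]) : g ∈ Ideal.ofList (rs.map C) • (⊤ : Submodule R[X] R[X]) ↔
      g.map (Ideal.Quotient.mk (Ideal.ofList rs)) = 0 := by
    have h1 : Ideal.ofList (rs.map C) = (Ideal.ofList rs).map C := (Ideal.map_ofList C rs).symm
    rw [h1, smul_eq_mul, Ideal.mul_top, Ideal.mem_map_C_iff, Polynomial.ext_iff]
    simp [Ideal.Quotient.eq_zero_iff_mem]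
  rw [key] at hf ⊢
  rw [smul_eq_mul, Polynomial.map_mul] at hf
  nontriviality R ⧸ Ideal.ofList rs
  exact ((hy.map _).mul_right_eq_zero_iff).mp hf

lemma Polynomial.isCohenMacaulayLocal_localization_of_comap_eq [IsLocalRing R] [IsNoetherianRing R]
    (h : IsCohenMacaulayLocal R) (p : Ideal R[X]) [p.IsPrime]
    (hp : p.comap C = maximalIdeal R) : IsCohenMacaulayLocal (Localization.AtPrime p) := by
  rw [isCohenMacaulayLocal_iff] at h
  obtain ⟨d, ⟨rs, rfl, hm, hr⟩, hd⟩ := h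
  have hle : (maximalIdeal R).map C ≤ p := Ideal.map_le_iff_le_comap.mpr hp.ge
  have hrsp : ∀ r ∈ rs.map C, r ∈ p := by
    intro r hr
    obtain ⟨s, hs, rfl⟩ := List.mem_map.mp hr
    exact hle (Ideal.mem_map_of_mem _ (hm s hs))
  have hmem (ss : List R[X]) (hss : ∀ r ∈ ss, r ∈ p) :
      ∀ r ∈ ss.map (algebraMap R[X] (Localization.AtPrime p)),
        r ∈ maximalIdeal (Localization.AtPrime p) := by
    intro r hr
    obtain ⟨s, hs, rfl⟩ := List.mem_map.mp hr
    exact (IsLocalization.AtPrime.to_map_mem_maximal_iff _ p s).mpr (hss s hs)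
  have hdim : ringKrullDim (Localization.AtPrime p) = p.height :=
    IsLocalization.AtPrime.ringKrullDim_eq_height p _
  rw [isCohenMacaulayLocal_iff, hdim]
  -- If `p` is extended from the maximal ideal, it has the same height and `rs` suffices. Otherwise
  -- `p` contains a monic polynomial, which adds one element to the sequence, and the height is at
  -- most `dim R + 1`.
  by_cases heq : p = (maximalIdeal R).map C
  · refine ⟨_, ⟨(rs.map C).map (algebraMap R[X] (Localization.AtPrime p)), rfl, hmem _ hrsp, ?_⟩, ?_⟩
    · exact IsWeaklyRegular.isRegular_of_isLocalization_of_mem _ p (hr.1.of_flat (S := R[X])) hrsp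
    · have hht : p.height = (maximalIdeal R).height := by rw [heq, height_map_C]
      rw [hht, maximalIdeal_height_eq_ringKrullDim]
      simpa using hd
  · have : (Ideal.comap C p).IsMaximal := by rw [hp]; infer_instance
    obtain ⟨y, hy, hyp⟩ := Polynomial.exists_monic_span_sup_map_eq R p this
      (by rw [hp]; exact heq)
    have hyp' : y ∈ p := by
      rw [hyp]
      exact Ideal.mem_sup_right (Ideal.mem_span_singleton_self y)
    have hss : ∀ r ∈ rs.map C ++ [y], r ∈ p := by
      intro r hr
      rcases List.mem_append.mp hr with hr | hr
      · exact hrsp r hr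
      · rw [List.mem_singleton.mp hr]; exact hyp'
    refine ⟨_, ⟨(rs.map C ++ [y]).map (algebraMap R[X] (Localization.AtPrime p)), rfl,
      hmem _ hss, ?_⟩, ?_⟩
    · exact IsWeaklyRegular.isRegular_of_isLocalization_of_mem _ p
        (isWeaklyRegular_append_monic hr.1 hy) hss
    · refine (Ideal.height_le_ringKrullDim_of_ne_top (Ideal.IsPrime.ne_top ‹_›)).trans ?_
      rw [ringKrullDim_of_isNoetherianRing]
      simp only [List.length_map, List.length_append, List.length_singleton]
      push_cast
      gcongr

/-- Polynomial rings over Cohen-Macaulay rings are Cohen-Macaulay. -/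
lemma Polynomial.isCohenMacaulayLocal_localization [IsNoetherianRing R]
    (h : ∀ (q : Ideal R) [q.IsPrime], IsCohenMacaulayLocal (Localization.AtPrime q))
    (p : Ideal R[X]) [p.IsPrime] : IsCohenMacaulayLocal (Localization.AtPrime p) := by
  obtain ⟨p', _, h1, -, ⟨e⟩⟩ := exists_localization_polynomial p (p.comap C) rfl
  exact (isCohenMacaulayLocal_localization_of_comap_eq (h (p.comap C)) p' h1).of_ringEquiv e

/-- The map from `R` to `R[X]` localized at the extended maximal ideal is flat with closed fibre a
field, so depth descends, and both rings have the same dimension. -/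
lemma Polynomial.isCohenMacaulayLocal_of_localization_map_C [IsLocalRing R] [IsNoetherianRing R]
    (p : Ideal R[X]) [p.IsPrime] (hp : p = (maximalIdeal R).map C)
    (h : IsCohenMacaulayLocal (Localization.AtPrime p)) : IsCohenMacaulayLocal R := by
  obtain ⟨d, h1, h2⟩ := isCohenMacaulayLocal_iff.mp h
  have : Module.Flat R (Localization.AtPrime p) := Module.Flat.trans R R[X] _
  have hm : (maximalIdeal R).map (algebraMap R (Localization.AtPrime p)) =
      maximalIdeal (Localization.AtPrime p) := by
    rw [IsScalarTower.algebraMap_eq R R[X], ← Ideal.map_map, algebraMap_eq, ← hp,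
      Localization.AtPrime.map_eq_maximalIdeal]
  refine isCohenMacaulayLocal_iff.mpr ⟨d, HasRegularSequence.of_flat hm
    (Algebra.linearMap R (Localization.AtPrime p)) (IsBaseChange.linearMap R _) h1, ?_⟩
  rwa [IsLocalization.AtPrime.ringKrullDim_eq_height p, hp, height_map_C,
    maximalIdeal_height_eq_ringKrullDim] at h2

lemma Polynomial.isCohenMacaulayLocal_localization_of_map_C [IsNoetherianRing R]
    (q : Ideal R) [q.IsPrime] (p : Ideal R[X]) [p.IsPrime] (hp : p = q.map C)
    (h : IsCohenMacaulayLocal (Localization.AtPrime p)) :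
    IsCohenMacaulayLocal (Localization.AtPrime q) := by
  have hc : p.comap C = q := by
    ext r
    rw [Ideal.mem_comap, hp, Ideal.mem_map_C_iff]
    refine ⟨fun h => by simpa using h 0, fun h n => ?_⟩
    rw [coeff_C]
    split_ifs
    exacts [h, q.zero_mem]
  obtain ⟨p', _, h1, h2, ⟨e⟩⟩ := exists_localization_polynomial p q hc
  refine isCohenMacaulayLocal_of_localization_map_C p' ?_ (h.of_ringEquiv e.symm)
  rw [h2, hp, ← Localization.AtPrime.map_eq_maximalIdeal, Ideal.map_map, Ideal.map_map]
  congr 1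
  ext r
  simp

end Polynomial

/-! ### Localizations along surjections of rings. -/

section Quotient

variable {A B : Type u} [CommRing A] [CommRing B]

/-- If the kernel of a surjection `A → B` dies in a localization of `A`, then that localization is
also a localization of `B`. -/
lemma nonempty_localization_ringEquiv_of_surjective (f : A →+* B) (hf : Function.Surjective f)
    (P : Ideal B) [P.IsPrime] (Q : Ideal A) [Q.IsPrime] (hQ : Q = P.comap f)
    (hker : ∀ a, f a = 0 → ∃ s ∉ Q, s * a = 0) :
    Nonempty (Localization.AtPrime Q ≃+* Localization.AtPrime P) := by
  subst hQ
  let _ : Algebra A (Localization.AtPrime P) := ((algebraMap B _).comp f).toAlgebra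
  have halg (a : A) : algebraMap A (Localization.AtPrime P) a = algebraMap B _ (f a) := rfl
  have : IsLocalization.AtPrime (Localization.AtPrime P) (P.comap f) := by
    refine ⟨?_, ?_, ?_⟩
    · rintro ⟨y, hy⟩
      rw [halg]
      exact IsLocalization.map_units (M := P.primeCompl) _ ⟨f y, hy⟩
    · intro z
      obtain ⟨⟨b, ⟨s, hs⟩⟩, hz⟩ := IsLocalization.surj P.primeCompl z
      obtain ⟨a, rfl⟩ := hf b
      obtain ⟨t, rfl⟩ := hf s
      exact ⟨⟨a, ⟨t, hs⟩⟩, hz⟩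
    · intro x y hxy
      rw [halg, halg, IsLocalization.eq_iff_exists P.primeCompl] at hxy
      obtain ⟨⟨c, hc⟩, h⟩ := hxy
      obtain ⟨s, rfl⟩ := hf c
      obtain ⟨t, ht, h'⟩ := hker (s * x - s * y) (by simpa [sub_eq_zero] using h)
      refine ⟨⟨t * s, Ideal.IsPrime.mul_notMem ‹_› ht hc⟩, ?_⟩
      linear_combination h'
  exact ⟨(IsLocalization.algEquiv (P.comap f).primeCompl (Localization.AtPrime (P.comap f))
    (Localization.AtPrime P)).toRingEquiv⟩

/-- Localizing further preserves the Cohen-Macaulay property. -/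
lemma IsCohenMacaulayLocal.localization_of_le [IsNoetherianRing A] {P Q : Ideal A} [P.IsPrime]
    [Q.IsPrime] (hPQ : P ≤ Q) (h : IsCohenMacaulayLocal (Localization.AtPrime Q)) :
    IsCohenMacaulayLocal (Localization.AtPrime P) := by
  have hd : Disjoint (Q.primeCompl : Set A) P :=
    Set.disjoint_left.mpr fun x hx hxP => hx (hPQ hxP)
  let P' := P.map (algebraMap A (Localization.AtPrime Q))
  have : P'.IsPrime := IsLocalization.isPrime_of_isPrime_disjoint Q.primeCompl _ _ ‹_› hd
  have : IsLocalization.AtPrime (Localization.AtPrime P') P := by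
    convert IsLocalization.isLocalization_isLocalization_atPrime_isLocalization Q.primeCompl
      (Localization.AtPrime P') P'
    exact (IsLocalization.under_map_of_isPrime_disjoint Q.primeCompl _ ‹_› hd).symm
  have e := (IsLocalization.algEquiv P.primeCompl (Localization.AtPrime P')
    (Localization.AtPrime P)).toRingEquiv
  exact (h.of_isLocalization P' (Localization.AtPrime P')).of_ringEquiv e

/-- If `B = A / (t)` for a nonzerodivisor `t` is Cohen-Macaulay at a prime, then so is `A`. -/
lemma IsCohenMacaulayLocal.localization_of_surjective [IsNoetherianRing A] (f : A →+* B)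
    (hf : Function.Surjective f) {t : A} (reg : IsSMulRegular A t)
    (hker : RingHom.ker f = Ideal.span {t}) (P : Ideal B) [P.IsPrime] (Q : Ideal A) [Q.IsPrime]
    (hQ : Q = P.comap f) (h : IsCohenMacaulayLocal (Localization.AtPrime P)) :
    IsCohenMacaulayLocal (Localization.AtPrime Q) := by
  have ht0 : f t = 0 := by
    rw [← RingHom.mem_ker, hker]
    exact Ideal.mem_span_singleton_self t
  have htQ : t ∈ Q := by rw [hQ, Ideal.mem_comap, ht0]; exact P.zero_mem
  refine IsCohenMacaulayLocal.of_surjective (Localization.localRingHom Q P f hQ) ?_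
    (t := algebraMap A _ t) ((IsLocalization.AtPrime.to_map_mem_maximal_iff _ Q t).mpr htQ) ?_ ?_ h
  · intro z
    obtain ⟨b, s, rfl⟩ := IsLocalization.exists_mk'_eq P.primeCompl z
    obtain ⟨a, rfl⟩ := hf b
    obtain ⟨s, hs⟩ := s
    obtain ⟨u, rfl⟩ := hf s
    have hu : u ∈ Q.primeCompl := by
      subst hQ
      exact hs
    refine ⟨IsLocalization.mk' _ a ⟨u, hu⟩, ?_⟩
    rw [Localization.localRingHom_mk']
  · exact reg.of_flat
  · ext z
    rw [RingHom.mem_ker]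
    constructor
    · intro hz
      obtain ⟨a, s, rfl⟩ := IsLocalization.exists_mk'_eq Q.primeCompl z
      rw [Localization.localRingHom_mk', IsLocalization.mk'_eq_zero_iff] at hz
      obtain ⟨⟨c, hc⟩, hcz⟩ := hz
      obtain ⟨u, rfl⟩ := hf c
      have hu : u ∈ Q.primeCompl := by
        subst hQ
        exact hc
      have h1 : u * a ∈ Ideal.span {t} := by
        rw [← hker, RingHom.mem_ker, map_mul]
        exact hcz
      obtain ⟨v, hv⟩ := Ideal.mem_span_singleton'.mp h1
      rw [Ideal.mem_span_singleton']
      refine ⟨IsLocalization.mk' _ v (⟨u, hu⟩ * s), ?_⟩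
      rw [mul_comm, IsLocalization.mul_mk'_eq_mk'_of_mul, mul_comm t, hv]
      rw [mul_comm u a, mul_comm ⟨u, hu⟩ s]
      exact IsLocalization.mk'_cancel (M := Q.primeCompl) (S := Localization.AtPrime Q) a s ⟨u, hu⟩
    · intro hz
      obtain ⟨v, rfl⟩ := Ideal.mem_span_singleton'.mp hz
      rw [map_mul, Localization.localRingHom_to_map, ht0]
      simp

end Quotient

/-! ### Monomial quotients: setting a variable equal to one, and reduction to the origin. -/

section MonomialIdeals

variable (k : Type u) [Field k] {σ τ : Type} {ι : Type*}

/-- The ideal generated by a family of monomials. -/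
noncomputable def monomialIdeal (b : ι → σ →₀ ℕ) : Ideal (MvPolynomial σ k) :=
  Ideal.span (Set.range fun i => MvPolynomial.monomial (b i) (1 : k))

/-- The quotient by an ideal generated by monomials. -/
abbrev MonomialQuotient (b : ι → σ →₀ ℕ) : Type u := MvPolynomial σ k ⧸ monomialIdeal k b

/-- The class of a variable in a monomial quotient. -/
noncomputable abbrev MonomialQuotient.var (b : ι → σ →₀ ℕ) (v : σ) : MonomialQuotient k b :=
  Ideal.Quotient.mk (monomialIdeal k b) (MvPolynomial.X v)

/-- Restriction of exponent vectors to a subset of the variables. -/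
noncomputable def restrictExps (e : τ ↪ σ) (b : ι → σ →₀ ℕ) (i : ι) : τ →₀ ℕ :=
  (b i).comapDomain e e.injective.injOn

@[simp] lemma restrictExps_apply (e : τ ↪ σ) (b : ι → σ →₀ ℕ) (i : ι) (a : τ) :
    restrictExps e b i a = b i (e a) := rfl

/-- A monomial quotient is Cohen-Macaulay at the origin. -/
def IsCohenMacaulayAtOrigin (b : ι → σ →₀ ℕ) : Prop :=
  ∀ (P : Ideal (MonomialQuotient k b)) [P.IsPrime], (∀ v, MonomialQuotient.var k b v ∈ P) →
    IsCohenMacaulayLocal (Localization.AtPrime P)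

/-- The inclusion of the variables other than `v`. -/
abbrev neEmbedding (v : σ) : {a // a ≠ v} ↪ σ := Function.Embedding.subtype _

/-- Separate the variable `v` from the others. -/
noncomputable def separateVariable (v : σ) [DecidableEq σ] :
    MvPolynomial σ k ≃ₐ[k] Polynomial (MvPolynomial {a // a ≠ v} k) :=
  (MvPolynomial.renameEquiv k (Equiv.optionSubtypeNe v).symm).trans
    (MvPolynomial.optionEquivLeft k _)

variable {k} in
lemma separateVariable_X_self (v : σ) [DecidableEq σ] :
    separateVariable k v (MvPolynomial.X v) = Polynomial.X := by
  simp [separateVariable, MvPolynomial.optionEquivLeft_X_none]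

variable {k} in
lemma separateVariable_X (v : σ) [DecidableEq σ] (a : {a // a ≠ v}) :
    separateVariable k v (MvPolynomial.X a.1) = Polynomial.C (MvPolynomial.X a) := by
  simp [separateVariable, MvPolynomial.optionEquivLeft_X_some, a.2]

variable {k} in
lemma separateVariable_monomial (v : σ) [DecidableEq σ] (b : ι → σ →₀ ℕ) (i : ι) :
    separateVariable k v (MvPolynomial.monomial (b i) 1) =
      Polynomial.X ^ (b i v) *
        Polynomial.C (MvPolynomial.monomial (restrictExps (neEmbedding v) b i) 1) := by
  simp only [separateVariable, AlgEquiv.trans_apply, MvPolynomial.renameEquiv_apply,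
    MvPolynomial.rename_monomial, MvPolynomial.optionEquivLeft_monomial]
  have h1 (o : Option {a // a ≠ v}) : Finsupp.mapDomain (Equiv.optionSubtypeNe v).symm (b i) o =
      b i (Equiv.optionSubtypeNe v o) := by
    conv_lhs => rw [← Equiv.symm_apply_apply (Equiv.optionSubtypeNe v) o]
    exact Finsupp.mapDomain_apply (Equiv.injective _) _ _
  have h2 : (Finsupp.mapDomain (Equiv.optionSubtypeNe v).symm (b i)).some =
      restrictExps (neEmbedding v) b i := by
    ext a
    simp [Finsupp.some_apply, h1]
  rw [h1, h2, Polynomial.X_pow_mul, Polynomial.C_mul_X_pow_eq_monomial]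
  rfl

/-- Each generator with `x_v` set to one becomes an original generator after multiplication by a
power of `x_v`; a common power serves for a finite combination. -/
lemma map_separateVariable_mem (b : ι → σ →₀ ℕ) (v : σ) [DecidableEq σ]
    {g : Polynomial (MvPolynomial {a // a ≠ v} k)}
    (hg : g ∈ (monomialIdeal k (restrictExps (neEmbedding v) b)).map Polynomial.C) :
    ∃ N : ℕ, Polynomial.X ^ N * g ∈
      (monomialIdeal k b).map (separateVariable k v : _ →+* Polynomial _) := by
  rw [monomialIdeal, Ideal.map_span] at hg
  induction hg using Submodule.span_induction with
  | mem x hx =>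
    obtain ⟨_, ⟨i, rfl⟩, rfl⟩ := hx
    refine ⟨b i v, ?_⟩
    rw [← separateVariable_monomial]
    exact Ideal.mem_map_of_mem _ (Ideal.subset_span ⟨i, rfl⟩)
  | zero => exact ⟨0, by simp⟩
  | add x y _ _ hx hy =>
    obtain ⟨N, hN⟩ := hx
    obtain ⟨M, hM⟩ := hy
    refine ⟨N + M, ?_⟩
    have : Polynomial.X ^ (N + M) * (x + y) =
      Polynomial.X ^ M * (Polynomial.X ^ N * x) + Polynomial.X ^ N * (Polynomial.X ^ M * y) := by
      ring
    rw [this]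
    exact add_mem (Ideal.mul_mem_left _ _ hN) (Ideal.mul_mem_left _ _ hM)
  | smul a x _ hx =>
    obtain ⟨N, hN⟩ := hx
    refine ⟨N, ?_⟩
    rw [smul_eq_mul, mul_left_comm]
    exact Ideal.mul_mem_left _ _ hN

/-- Away from `x_v = 0`, a monomial quotient looks like the polynomial ring over the monomial
quotient in which `x_v` is replaced by one. -/
lemma exists_hom_polynomial_restrictExps (b : ι → σ →₀ ℕ) (v : σ) :
    ∃ f : MonomialQuotient k b →+*
        Polynomial (MonomialQuotient k (restrictExps (neEmbedding v) b)),
      Function.Surjective f ∧ f (MonomialQuotient.var k b v) = Polynomial.X ∧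
      (∀ a : {a // a ≠ v}, f (MonomialQuotient.var k b a) =
        Polynomial.C (MonomialQuotient.var k (restrictExps (neEmbedding v) b) a)) ∧
      ∀ z, f z = 0 → ∃ N : ℕ, MonomialQuotient.var k b v ^ N * z = 0 := by
  classical
  let J0 := monomialIdeal k (restrictExps (neEmbedding v) b)
  let g : MvPolynomial σ k →+* Polynomial (MonomialQuotient k (restrictExps (neEmbedding v) b)) :=
    (Polynomial.mapRingHom (Ideal.Quotient.mk J0)).comp (separateVariable k v : _ →+* Polynomial _)
  have hg (x) : g x = (separateVariable k v x).map (Ideal.Quotient.mk J0) := rfl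
  have hgJ : ∀ x ∈ monomialIdeal k b, g x = 0 := by
    suffices h : monomialIdeal k b ≤ RingHom.ker g from fun x hx => h hx
    rw [monomialIdeal, Ideal.span_le]
    rintro _ ⟨i, rfl⟩
    have h0 : Ideal.Quotient.mk J0
        (MvPolynomial.monomial (restrictExps (neEmbedding v) b i) 1) = 0 := by
      rw [Ideal.Quotient.eq_zero_iff_mem]
      exact Ideal.subset_span ⟨i, rfl⟩
    simp only [SetLike.mem_coe, RingHom.mem_ker]
    rw [hg, separateVariable_monomial, Polynomial.map_mul, Polynomial.map_C, h0]
    simp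
  have hgs : Function.Surjective g :=
    (Polynomial.map_surjective _ Ideal.Quotient.mk_surjective).comp
      (separateVariable k v).surjective
  refine ⟨Ideal.Quotient.lift _ g hgJ, Ideal.Quotient.lift_surjective_of_surjective _ _ hgs,
    ?_, ?_, ?_⟩
  · rw [Ideal.Quotient.lift_mk, hg, separateVariable_X_self, Polynomial.map_X]
  · intro a
    rw [Ideal.Quotient.lift_mk, hg, separateVariable_X, Polynomial.map_C]
  · intro z hz
    obtain ⟨x, rfl⟩ := Ideal.Quotient.mk_surjective z
    rw [Ideal.Quotient.lift_mk, hg] at hz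
    have hmem : separateVariable k v x ∈ J0.map Polynomial.C := by
      rw [Ideal.mem_map_C_iff]
      intro n
      rw [← Ideal.Quotient.eq_zero_iff_mem, ← Polynomial.coeff_map, hz, Polynomial.coeff_zero]
    obtain ⟨N, hN⟩ := map_separateVariable_mem k b v hmem
    refine ⟨N, ?_⟩
    rw [← map_pow, ← map_mul, Ideal.Quotient.eq_zero_iff_mem]
    have h1 : Polynomial.X ^ N * separateVariable k v x =
        (separateVariable k v : _ →+* Polynomial (MvPolynomial {a // a ≠ v} k))
          (MvPolynomial.X v ^ N * x) := by
      simp [separateVariable_X_self]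
    rw [h1] at hN
    obtain ⟨y, hy, hxy⟩ := (Ideal.mem_map_iff_of_surjective _
      (separateVariable k v).surjective).mp hN
    rw [← (separateVariable k v).injective hxy]
    exact hy

variable {k}

/-- The pullback `Q₁` of `P[X]` lies below the pullback `Q₂` of `(P, X)`, which contains all
variables, so the Cohen-Macaulay property passes from `Q₂` to `Q₁`. Since `x_v ∉ Q₁`, localizing at
`Q₁` is localizing the polynomial ring at `P[X]`, from which the property descends to `P`. -/
lemma IsCohenMacaulayAtOrigin.restrictExps_neEmbedding [Finite σ] {b : ι → σ →₀ ℕ}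
    (h : IsCohenMacaulayAtOrigin k b) (v : σ) :
    IsCohenMacaulayAtOrigin k (restrictExps (neEmbedding v) b) := by
  intro P _ hP
  obtain ⟨f, hf, hfv, hfa, hker⟩ := exists_hom_polynomial_restrictExps k b v
  have hp : (P.map Polynomial.C).IsPrime := Ideal.isPrime_map_C_of_isPrime
  let Q₁ := (P.map Polynomial.C).comap f
  let Q₂ := (P.comap (Polynomial.evalRingHom 0)).comap f
  have hle : Q₁ ≤ Q₂ := by
    refine Ideal.comap_mono (Ideal.map_le_iff_le_comap.mpr fun x hx => ?_)
    simpa using hx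
  have hQ₂ : ∀ a, MonomialQuotient.var k b a ∈ Q₂ := by
    intro a
    simp only [Q₂, Ideal.mem_comap]
    by_cases ha : a = v
    · subst ha
      rw [hfv]
      simp
    · rw [hfa ⟨a, ha⟩]
      simpa using hP _
  have h1 : IsCohenMacaulayLocal (Localization.AtPrime Q₁) := (h Q₂ hQ₂).localization_of_le hle
  have hv : MonomialQuotient.var k b v ∉ Q₁ := by
    intro hv
    simp only [Q₁, Ideal.mem_comap] at hv
    rw [hfv, Ideal.mem_map_C_iff] at hv
    exact (Ideal.ne_top_iff_one P).mp (Ideal.IsPrime.ne_top ‹_›) (by simpa using hv 1)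
  obtain ⟨e⟩ := nonempty_localization_ringEquiv_of_surjective f hf (P.map Polynomial.C) Q₁ rfl
    fun a ha => by
      obtain ⟨N, hN⟩ := hker a ha
      exact ⟨_, fun h => hv (Ideal.IsPrime.mem_of_pow_mem inferInstance _ h), hN⟩
  exact Polynomial.isCohenMacaulayLocal_localization_of_map_C P _ rfl (h1.of_ringEquiv e)

/-- A monomial quotient that is Cohen-Macaulay at the origin is Cohen-Macaulay everywhere. -/
theorem IsCohenMacaulayAtOrigin.isCohenMacaulayLocal {n : ℕ} :
    ∀ {σ : Type} [Finite σ] (_ : Nat.card σ = n) {b : ι → σ →₀ ℕ}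
      (_ : IsCohenMacaulayAtOrigin k b) (P : Ideal (MonomialQuotient k b)) [P.IsPrime],
      IsCohenMacaulayLocal (Localization.AtPrime P) := by
  induction n with
  | zero =>
    intro σ _ hσ b h P _
    have : IsEmpty σ := (Nat.card_eq_zero.mp hσ).resolve_right (not_infinite_iff_finite.mpr ‹_›)
    exact h P fun v => isEmptyElim v
  | succ n ih =>
    intro σ _ hσ b h P _
    -- A prime that misses some `x_v` is a prime of a polynomial ring over the quotient with `x_v =
    -- 1`, which has one variable fewer.
    by_cases hP : ∀ v, MonomialQuotient.var k b v ∈ P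
    · exact h P hP
    push Not at hP
    obtain ⟨v, hv⟩ := hP
    classical
    have := Fintype.ofFinite σ
    have hcard : Nat.card {a // a ≠ v} = n := by
      rw [Nat.card_eq_fintype_card] at hσ ⊢
      simp [hσ]
    obtain ⟨f, hf, -, -, hker⟩ := exists_hom_polynomial_restrictExps k b v
    have hker' : RingHom.ker f ≤ P := by
      intro z hz
      obtain ⟨N, hN⟩ := hker z hz
      refine (Ideal.IsPrime.mem_or_mem ‹P.IsPrime› (hN ▸ P.zero_mem :
        MonomialQuotient.var k b v ^ N * z ∈ P)).resolve_left fun h => hv ?_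
      exact Ideal.IsPrime.mem_of_pow_mem inferInstance _ h
    have hp : (P.map f).IsPrime := Ideal.map_isPrime_of_surjective hf hker'
    obtain ⟨e⟩ := nonempty_localization_ringEquiv_of_surjective f hf (P.map f) P
      (by rw [Ideal.comap_map_of_surjective' f hf, sup_eq_left.mpr hker'])
      fun a ha => by
        obtain ⟨N, hN⟩ := hker a ha
        exact ⟨_, fun h => hv (Ideal.IsPrime.mem_of_pow_mem inferInstance _ h), hN⟩
    refine IsCohenMacaulayLocal.of_ringEquiv e.symm ?_
    exact Polynomial.isCohenMacaulayLocal_localization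
      (fun q _ => ih hcard (h.restrictExps_neEmbedding v) q) _

end MonomialIdeals

/-! ### Vertex covers, heights and unmixedness. -/

section Heights

variable (k : Type u) [Field k] {σ τ : Type} {ι : Type*}

/-- The prime ideal generated by a set of variables. -/
noncomputable def variableIdeal (T : Finset σ) : Ideal (MvPolynomial σ k) :=
  Ideal.span (MvPolynomial.X '' (T : Set σ))

open Classical in
/-- The substitution of zero for a set of variables. -/
noncomputable def killVariables (T : Finset σ) : MvPolynomial σ k →ₐ[k] MvPolynomial σ k :=
  MvPolynomial.aeval fun v => if v ∈ T then 0 else MvPolynomial.X v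

/-- Modulo the variables in `T` the substitution is the identity. Being the kernel of a map to a
domain, the ideal is prime. -/
lemma ker_killVariables (T : Finset σ) : RingHom.ker (killVariables k T) = variableIdeal k T := by
  apply le_antisymm
  · intro x hx
    have h : (Ideal.Quotient.mkₐ k (variableIdeal k T)).comp (killVariables k T) =
        Ideal.Quotient.mkₐ k (variableIdeal k T) := by
      apply MvPolynomial.algHom_ext
      intro v
      simp only [killVariables, AlgHom.comp_apply, MvPolynomial.aeval_X]
      split_ifs with hv
      · rw [map_zero, eq_comm, Ideal.Quotient.mkₐ_eq_mk, Ideal.Quotient.eq_zero_iff_mem]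
        exact Ideal.subset_span ⟨v, hv, rfl⟩
      · rfl
    have h' := DFunLike.congr_fun h x
    rw [AlgHom.comp_apply, (RingHom.mem_ker).mp hx, map_zero, eq_comm, Ideal.Quotient.mkₐ_eq_mk,
      Ideal.Quotient.eq_zero_iff_mem] at h'
    exact h'
  · rw [variableIdeal, Ideal.span_le]
    rintro _ ⟨v, hv, rfl⟩
    have hv' : v ∈ T := hv
    simp [RingHom.mem_ker, killVariables, hv']

instance variableIdeal_isPrime (T : Finset σ) : (variableIdeal k T).IsPrime := by
  rw [← ker_killVariables]
  exact RingHom.ker_isPrime _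

lemma X_mem_variableIdeal {T : Finset σ} {v : σ} :
    (MvPolynomial.X v : MvPolynomial σ k) ∈ variableIdeal k T ↔ v ∈ T := by
  refine ⟨fun h => ?_, fun h => Ideal.subset_span ⟨v, h, rfl⟩⟩
  rw [← ker_killVariables, RingHom.mem_ker] at h
  by_contra hv
  simp [killVariables, hv] at h

lemma variableIdeal_lt {T U : Finset σ} (h : T ⊂ U) : variableIdeal k T < variableIdeal k U := by
  obtain ⟨hle, v, hvU, hvT⟩ := Finset.ssubset_iff_exists_cons_subset.mp h |>.elim
    fun v ⟨hv, hc⟩ => (⟨h.1, v, hc (Finset.mem_cons_self _ _), hv⟩ :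
      T ⊆ U ∧ ∃ v, v ∈ U ∧ v ∉ T)
  refine lt_of_le_of_ne (Ideal.span_mono (Set.image_mono hle)) fun heq => hvT ?_
  rw [← X_mem_variableIdeal k, heq, X_mem_variableIdeal]
  exact hvU

lemma card_le_height_variableIdeal (T : Finset σ) :
    (T.card : ℕ∞) ≤ (variableIdeal k T).height := by
  classical
  induction T using Finset.induction_on with
  | empty => simp
  | insert v T hv ih =>
    rw [Finset.card_insert_of_notMem hv]
    push_cast
    exact (add_le_add_left ih 1).trans
      (Ideal.height_add_one_le_of_lt_of_isPrime (variableIdeal_lt k (Finset.ssubset_insert hv)))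

/-- Krull's height theorem bounds the height above; adding the variables one at a time gives a chain
of primes that bounds it below. -/
lemma height_variableIdeal [Finite σ] (T : Finset σ) :
    (variableIdeal k T).height = T.card := by
  classical
  refine le_antisymm ?_ (card_le_height_variableIdeal k T)
  have h := Ideal.height_le_card_of_mem_minimalPrimes_span (p := variableIdeal k T)
    (s := MvPolynomial.X '' (T : Set σ)) (T.finite_toSet.image _)
    (by
      change variableIdeal k T ∈ (variableIdeal k T).minimalPrimes
      rw [Ideal.minimalPrimes_eq_subsingleton_self]
      rfl)
  refine h.trans ?_
  rw [Nat.cast_le]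
  exact (Set.ncard_image_le T.finite_toSet).trans (Set.ncard_coe_finset T).le

lemma ringKrullDim_quotient_variableIdeal_add_card_le (T : Finset σ) :
    ringKrullDim (MvPolynomial σ k ⧸ variableIdeal k T) + T.card ≤
      ringKrullDim (MvPolynomial σ k) := by
  classical
  induction T using Finset.induction_on with
  | empty => simpa using ringKrullDim_quotient_le _
  | insert v T hv ih =>
    rw [Finset.card_insert_of_notMem hv]
    refine le_trans ?_ ih
    push_cast
    rw [add_comm (T.card : WithBot ℕ∞) 1, ← add_assoc]
    gcongr
    exact ringKrullDim_quotient_add_one_le_of_lt (variableIdeal_lt k (Finset.ssubset_insert hv))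

/-- A set of variables that meets the support of each of the monomials. -/
def IsCover (b : ι → σ →₀ ℕ) (T : Finset σ) : Prop := ∀ i, ∃ v ∈ T, b i v ≠ 0

variable {k}

lemma monomial_mem_of_X_mem {I : Ideal (MvPolynomial σ k)} {m : σ →₀ ℕ} {v : σ} (hm : m v ≠ 0)
    (hv : MvPolynomial.X v ∈ I) : MvPolynomial.monomial m 1 ∈ I := by
  refine I.mem_of_dvd ?_ hv
  rw [MvPolynomial.X, MvPolynomial.monomial_dvd_monomial]
  exact ⟨Or.inr (Finsupp.single_le_iff.mpr (Nat.one_le_iff_ne_zero.mpr hm)), one_dvd _⟩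

lemma exists_X_mem_of_monomial_mem {P : Ideal (MvPolynomial σ k)} [P.IsPrime] {m : σ →₀ ℕ}
    (hm : MvPolynomial.monomial m 1 ∈ P) : ∃ v, MvPolynomial.X v ∈ P ∧ m v ≠ 0 := by
  rw [MvPolynomial.monomial_eq, map_one, one_mul, Finsupp.prod, Ideal.IsPrime.prod_mem_iff] at hm
  obtain ⟨v, hv, h⟩ := hm
  exact ⟨v, Ideal.IsPrime.mem_of_pow_mem ‹_› _ h, Finsupp.mem_support_iff.mp hv⟩

lemma IsCover.monomialIdeal_le {b : ι → σ →₀ ℕ} {T : Finset σ} (hT : IsCover b T) :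
    monomialIdeal k b ≤ variableIdeal k T := by
  rw [monomialIdeal, Ideal.span_le]
  rintro _ ⟨i, rfl⟩
  obtain ⟨v, hv, h⟩ := hT i
  exact monomial_mem_of_X_mem h ((X_mem_variableIdeal k).mpr hv)

/-- A prime containing a monomial contains one of its variables; hence covers control all primes
over a monomial ideal. -/
lemma exists_isCover_of_le [Finite σ] {b : ι → σ →₀ ℕ} {P : Ideal (MvPolynomial σ k)} [P.IsPrime]
    (h : monomialIdeal k b ≤ P) :
    ∃ T : Finset σ, IsCover b T ∧ variableIdeal k T ≤ P ∧
      ∀ v, v ∈ T ↔ MvPolynomial.X v ∈ P := by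
  classical
  have := Fintype.ofFinite σ
  refine ⟨Finset.univ.filter fun v => MvPolynomial.X v ∈ P, fun i => ?_, ?_, by simp⟩
  · obtain ⟨v, hv, h'⟩ := exists_X_mem_of_monomial_mem (h (Ideal.subset_span ⟨i, rfl⟩))
    exact ⟨v, by simpa using hv, h'⟩
  · rw [variableIdeal, Ideal.span_le]
    rintro _ ⟨v, hv, rfl⟩
    simpa using hv

/-- The height of a monomial ideal is the least size of a set of variables that meets the supports
of the generators. -/
lemma height_monomialIdeal_eq_iff [Finite σ] {b : ι → σ →₀ ℕ} {c : ℕ} :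
    (monomialIdeal k b).height = c ↔
      (∃ T, IsCover b T ∧ T.card ≤ c) ∧ ∀ T, IsCover b T → c ≤ T.card := by
  have hle {T : Finset σ} (hT : IsCover b T) : (monomialIdeal k b).height ≤ T.card :=
    (Ideal.height_mono hT.monomialIdeal_le).trans (height_variableIdeal k T).le
  constructor
  · intro h
    refine ⟨?_, fun T hT => by exact_mod_cast h ▸ hle hT⟩
    obtain ⟨P, hP, hIP, hht⟩ := Ideal.exists_isPrime_height_eq h
    obtain ⟨T, hT, hTP, -⟩ := exists_isCover_of_le hIP
    refine ⟨T, hT, ?_⟩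
    have := Ideal.height_mono hTP
    rw [height_variableIdeal, hht] at this
    exact_mod_cast this
  · rintro ⟨⟨T, hT, hc⟩, h⟩
    refine le_antisymm ((hle hT).trans (by exact_mod_cast hc)) ?_
    rw [Ideal.height_eq_inf_minimalPrimes]
    refine le_iInf₂ fun P hP => ?_
    have := hP.isPrime
    obtain ⟨U, hU, hUP, -⟩ := exists_isCover_of_le hP.1.2
    refine le_trans ?_ (Ideal.height_mono hUP)
    rw [height_variableIdeal]
    exact_mod_cast h U hU

/-- The image of a prime ideal generated by variables in a monomial quotient. -/
lemma IsCover.isPrime_map {b : ι → σ →₀ ℕ} {T : Finset σ} (hT : IsCover b T) :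
    ((variableIdeal k T).map (Ideal.Quotient.mk (monomialIdeal k b))).IsPrime :=
  Ideal.map_isPrime_of_surjective Ideal.Quotient.mk_surjective
    (by rw [Ideal.mk_ker]; exact hT.monomialIdeal_le)

lemma IsCover.comap_map {b : ι → σ →₀ ℕ} {T : Finset σ} (hT : IsCover b T) :
    ((variableIdeal k T).map (Ideal.Quotient.mk (monomialIdeal k b))).comap
      (Ideal.Quotient.mk (monomialIdeal k b)) = variableIdeal k T := by
  rw [Ideal.comap_map_of_surjective' _ Ideal.Quotient.mk_surjective, Ideal.mk_ker,
    sup_eq_left.mpr hT.monomialIdeal_le]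

lemma IsCover.mono {b : ι → σ →₀ ℕ} {T U : Finset σ} (hT : IsCover b T) (h : T ⊆ U) :
    IsCover b U := fun i => by
  obtain ⟨v, hv, hi⟩ := hT i
  exact ⟨v, h hv, hi⟩

/-- Once `T` is a cover, adding further variables one by one gives a strict chain of primes in the
quotient. -/
lemma IsCover.card_le_height_map_add [Finite σ] {b : ι → σ →₀ ℕ} {T : Finset σ} (hT : IsCover b T)
    (U : Finset σ) (hTU : T ⊆ U) :
    (U.card : ℕ∞) ≤
      ((variableIdeal k U).map (Ideal.Quotient.mk (monomialIdeal k b))).height + T.card := by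
  classical
  suffices h : ∀ V : Finset σ, ((T ∪ V).card : ℕ∞) ≤
      ((variableIdeal k (T ∪ V)).map (Ideal.Quotient.mk (monomialIdeal k b))).height + T.card by
    simpa [Finset.union_eq_right.mpr hTU] using h U
  intro V
  induction V using Finset.induction_on with
  | empty => simp
  | insert v V hv ih =>
    rw [Finset.union_insert]
    by_cases hvV : v ∈ T ∪ V
    · rwa [Finset.insert_eq_of_mem hvV]
    have h1 := hT.mono (Finset.subset_union_left (s₂ := V))
    have h2 := h1.mono (Finset.subset_insert v _)
    have hp1 := h1.isPrime_map (k := k)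
    have hp2 := h2.isPrime_map (k := k)
    have hlt : (variableIdeal k (T ∪ V)).map (Ideal.Quotient.mk (monomialIdeal k b)) <
        (variableIdeal k (insert v (T ∪ V))).map (Ideal.Quotient.mk (monomialIdeal k b)) := by
      have h3 := variableIdeal_lt k (Finset.ssubset_insert hvV)
      refine lt_of_le_of_ne (Ideal.map_mono h3.le) fun heq => h3.ne ?_
      rw [← h1.comap_map (k := k), heq, h2.comap_map]
    rw [Finset.card_insert_of_notMem hvV]
    push_cast
    calc ((T ∪ V).card : ℕ∞) + 1
        ≤ ((variableIdeal k (T ∪ V)).map (Ideal.Quotient.mk (monomialIdeal k b))).height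
          + T.card + 1 := by gcongr
      _ = ((variableIdeal k (T ∪ V)).map (Ideal.Quotient.mk (monomialIdeal k b))).height + 1
          + T.card := by ring
      _ ≤ _ := by
        gcongr
        exact Ideal.height_add_one_le_of_lt_of_isPrime hlt

lemma ringKrullDim_localization_quotient_le {A B : Type u} [CommRing A] [CommRing B] (f : A →+* B)
    (hf : Function.Surjective f) (Q : Ideal B) [Q.IsPrime] (I : Ideal A)
    (J : Ideal (Localization.AtPrime Q)) (hIJ : I ≤ (J.comap (algebraMap B _)).comap f) :
    ringKrullDim (Localization.AtPrime Q ⧸ J) ≤ ringKrullDim (A ⧸ I) := by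
  let h : A →+* Localization.AtPrime Q ⧸ J :=
    ((Ideal.Quotient.mk J).comp (algebraMap B _)).comp f
  have hinj : Function.Injective (Ideal.comap h) := by
    intro J₁ J₂ h12
    apply Ideal.comap_injective_of_surjective _ Ideal.Quotient.mk_surjective
    rw [← IsLocalization.map_under Q.primeCompl _ (Ideal.comap (Ideal.Quotient.mk J) J₁),
      ← IsLocalization.map_under Q.primeCompl _ (Ideal.comap (Ideal.Quotient.mk J) J₂)]
    congr 1
    exact Ideal.comap_injective_of_surjective f hf h12
  rw [ringKrullDim_quotient I]
  refine Order.krullDim_le_of_strictMono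
    (fun p => ⟨⟨p.asIdeal.comap h, inferInstance⟩, fun x hx => ?_⟩) fun p q hpq => ?_
  · have h1 : algebraMap B (Localization.AtPrime Q) (f x) ∈ J := hIJ hx
    change Ideal.Quotient.mk J (algebraMap B _ (f x)) ∈ p.asIdeal
    rw [Ideal.Quotient.eq_zero_iff_mem.mpr h1]
    exact p.asIdeal.zero_mem
  · refine lt_of_le_of_ne (Ideal.comap_mono hpq.le : p.asIdeal.comap h ≤ q.asIdeal.comap h)
      fun heq => hpq.ne (PrimeSpectrum.ext (hinj ?_))
    exact congrArg (fun x => x.1.asIdeal) heq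

/-- In a Cohen-Macaulay local ring, each minimal prime has full dimension. -/
lemma IsCohenMacaulayLocal.height_le_ringKrullDim_quotient {A B : Type u} [CommRing A] [CommRing B]
    [IsNoetherianRing B] (f : A →+* B) (hf : Function.Surjective f) (Q : Ideal B) [Q.IsPrime]
    (h : IsCohenMacaulayLocal (Localization.AtPrime Q)) {q : Ideal B} (hq : q.IsPrime) (hqQ : q ≤ Q)
    (hmin : ∀ q' : Ideal B, q'.IsPrime → q' ≤ q → q' = q) :
    (Q.height : WithBot ℕ∞) ≤ ringKrullDim (A ⧸ q.comap f) := by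
  have hd : Disjoint (Q.primeCompl : Set B) q :=
    Set.disjoint_left.mpr fun x hx hxq => hx (hqQ hxq)
  let J : Ideal (Localization.AtPrime Q) := q.map (algebraMap B _)
  have hJp : J.IsPrime := IsLocalization.isPrime_of_isPrime_disjoint Q.primeCompl _ _ hq hd
  have hJq : J.comap (algebraMap B _) = q :=
    IsLocalization.under_map_of_isPrime_disjoint Q.primeCompl _ hq hd
  have hJass : J ∈ associatedPrimes (Localization.AtPrime Q) (Localization.AtPrime Q) := by
    apply Module.associatedPrimes.minimalPrimes_annihilator_subset_associatedPrimes
    rw [Module.annihilator_eq_bot.mpr inferInstance]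
    refine ⟨⟨hJp, bot_le⟩, ?_⟩
    rintro J' ⟨hJ', -⟩ hle
    have h1 := hmin (J'.comap (algebraMap B _)) inferInstance
      ((Ideal.comap_mono hle).trans hJq.le)
    rw [← IsLocalization.map_under Q.primeCompl _ J']
    exact (congrArg (Ideal.map (algebraMap B _)) h1).ge
  obtain ⟨d, h1, h2⟩ := isCohenMacaulayLocal_iff.mp h
  rw [IsLocalization.AtPrime.ringKrullDim_eq_height Q] at h2
  exact h2.trans ((h1.le_ringKrullDim_quotient hJass).trans
    (ringKrullDim_localization_quotient_le f hf Q _ J (by rw [hJq])))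

/-- Cohen-Macaulay monomial ideals are unmixed: minimal covers have the same size. -/
lemma IsCohenMacaulayAtOrigin.card_le_card [Finite σ] {b : ι → σ →₀ ℕ}
    (h : IsCohenMacaulayAtOrigin k b) {T U : Finset σ} (hT : IsCover b T)
    (hmin : ∀ T' ⊆ T, IsCover b T' → T' = T) (hU : IsCover b U) : T.card ≤ U.card := by
  classical
  have := Fintype.ofFinite σ
  have hQp := (hU.mono (Finset.subset_univ U)).isPrime_map (k := k)
  have hCM := h ((variableIdeal k Finset.univ).map (Ideal.Quotient.mk (monomialIdeal k b))) fun v =>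
    Ideal.mem_map_of_mem _ ((X_mem_variableIdeal k (T := Finset.univ)).mpr (Finset.mem_univ v))
  -- The prime of the minimal cover `T` is a minimal prime. Hence the height of the origin, at least
  -- `|σ| - |U|`, is at most the dimension modulo `T`, which is at most `|σ| - |T|`.
  have h1 := hCM.height_le_ringKrullDim_quotient (Ideal.Quotient.mk (monomialIdeal k b))
    Ideal.Quotient.mk_surjective _ hT.isPrime_map
    (Ideal.map_mono (Ideal.span_mono (Set.image_mono (Finset.coe_subset.mpr
      (Finset.subset_univ T))))) (by
      intro q' _ hle
      obtain ⟨T', hT', hT'q, hmem⟩ := exists_isCover_of_le (b := b)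
        (P := q'.comap (Ideal.Quotient.mk (monomialIdeal k b))) (by
          intro x hx
          rw [Ideal.mem_comap, Ideal.Quotient.eq_zero_iff_mem.mpr hx]
          exact q'.zero_mem)
      have hT'T : T' ⊆ T := by
        intro v hv
        rw [hmem] at hv
        have h1 := Ideal.comap_mono (f := Ideal.Quotient.mk (monomialIdeal k b)) hle hv
        rwa [hT.comap_map, X_mem_variableIdeal] at h1
      rw [hmin T' hT'T hT'] at hT'q
      exact le_antisymm hle (Ideal.map_le_iff_le_comap.mpr hT'q))
  rw [hT.comap_map] at h1
  have h2 := hU.card_le_height_map_add (k := k) Finset.univ (Finset.subset_univ _)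
  have h3 := ringKrullDim_quotient_variableIdeal_add_card_le k T
  rw [MvPolynomial.ringKrullDim_of_isNoetherianRing, ringKrullDim_eq_zero_of_field, zero_add] at h3
  have h4 : (((Finset.univ : Finset σ).card : ℕ∞) : WithBot ℕ∞) + (T.card : WithBot ℕ∞) ≤
      (Nat.card σ : WithBot ℕ∞) + (U.card : ℕ∞) := by
    calc _ ≤ _ := add_le_add_left (WithBot.coe_le_coe.mpr h2) _
      _ = _ := by rw [WithBot.coe_add]; exact add_right_comm _ _ _
      _ ≤ _ := add_le_add_left ((add_le_add_left h1 _).trans h3) _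
  have h5 : (Finset.univ : Finset σ).card + T.card ≤ Nat.card σ + U.card := by exact_mod_cast h4
  rw [Finset.card_univ, ← Nat.card_eq_fintype_card] at h5
  omega

end Heights

/-! ### Setting several variables equal to one. -/

section Specialization

variable {k : Type u} [Field k] {σ τ : Type} {ι : Type*}

lemma IsCohenMacaulay.of_ringEquiv {R S : Type u} [CommRing R] [CommRing S] (e : R ≃+* S)
    (h : IsCohenMacaulay R) : IsCohenMacaulay S := by
  have := h.1
  refine ⟨isNoetherianRing_of_ringEquiv R e, fun p hp => ?_⟩
  exact (h.2 (p.comap e)).of_ringEquiv (IsLocalization.ringEquivOfRingEquiv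
    (Localization.AtPrime (p.comap e)) (Localization.AtPrime p) e (e.map_primeCompl_comap_eq p))

lemma isCohenMacaulay_monomialQuotient_iff [Finite σ] {b : ι → σ →₀ ℕ} :
    IsCohenMacaulay (MonomialQuotient k b) ↔ IsCohenMacaulayAtOrigin k b :=
  ⟨fun h P _ _ => h.2 P, fun h => ⟨inferInstance, fun P _ => h.isCohenMacaulayLocal rfl P⟩⟩

lemma isCohenMacaulay_restrictExps_equiv (e : τ ≃ σ) {b : ι → σ →₀ ℕ}
    (h : IsCohenMacaulay (MonomialQuotient k b)) :
    IsCohenMacaulay (MonomialQuotient k (restrictExps e.toEmbedding b)) := by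
  refine h.of_ringEquiv (Ideal.quotientEquiv _ _
    (MvPolynomial.renameEquiv k e.symm).toRingEquiv ?_)
  rw [monomialIdeal, monomialIdeal, Ideal.map_span, ← Set.range_comp]
  congr 2
  ext1 i
  have h1 : restrictExps e.toEmbedding b i = (b i).mapDomain e.symm := by
    ext a
    rw [restrictExps_apply, Equiv.toEmbedding_apply]
    conv_rhs => rw [← e.symm_apply_apply a]
    exact (Finsupp.mapDomain_apply e.symm.injective _ _).symm
  simp [h1, MvPolynomial.rename_monomial]

/-- Setting variables equal to one preserves the Cohen-Macaulay property of monomial quotients. -/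
lemma isCohenMacaulay_restrictExps {n : ℕ} :
    ∀ {σ : Type} [Finite σ] (_ : Nat.card σ = n) (e : τ ↪ σ) {b : ι → σ →₀ ℕ}
      (_ : IsCohenMacaulay (MonomialQuotient k b)),
      IsCohenMacaulay (MonomialQuotient k (restrictExps e b)) := by
  induction n with
  | zero =>
    intro σ _ hσ e b h
    have : IsEmpty σ := (Nat.card_eq_zero.mp hσ).resolve_right (not_infinite_iff_finite.mpr ‹_›)
    exact isCohenMacaulay_restrictExps_equiv
      (Equiv.ofBijective e ⟨e.injective, fun a => isEmptyElim a⟩) h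
  | succ n ih =>
    intro σ _ hσ e b h
    by_cases he : Function.Surjective e
    · exact isCohenMacaulay_restrictExps_equiv (Equiv.ofBijective e ⟨e.injective, he⟩) h
    · simp only [Function.Surjective, not_forall, not_exists] at he
      obtain ⟨v, hv⟩ := he
      classical
      have := Fintype.ofFinite σ
      have hcard : Nat.card {a // a ≠ v} = n := by
        rw [Nat.card_eq_fintype_card] at hσ ⊢
        simp [hσ]
      let e' : τ ↪ {a // a ≠ v} := ⟨fun a => ⟨e a, hv a⟩, fun x y hxy =>
        e.injective (congrArg Subtype.val hxy)⟩
      have hb : restrictExps e b = restrictExps e' (restrictExps (neEmbedding v) b) := by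
        funext i
        ext a
        rfl
      rw [hb]
      exact ih hcard e' (isCohenMacaulay_monomialQuotient_iff.mpr
        ((isCohenMacaulay_monomialQuotient_iff.mp h).restrictExps_neEmbedding v))

/-- Setting variables equal to one preserves the height of Cohen-Macaulay monomial ideals. -/
lemma height_monomialIdeal_restrictExps [Finite σ] [Finite τ] (e : τ ↪ σ) {b : ι → σ →₀ ℕ} {c : ℕ}
    (h : IsCohenMacaulay (MonomialQuotient k b)) (hc : (monomialIdeal k b).height = c)
    (h0 : ∀ i, restrictExps e b i ≠ 0) :
    (monomialIdeal k (restrictExps e b)).height = c := by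
  classical
  have := Fintype.ofFinite τ
  obtain ⟨⟨U, hU, hUc⟩, hmin⟩ := height_monomialIdeal_eq_iff.mp hc
  have hmap {T : Finset τ} (hT : IsCover (restrictExps e b) T) : IsCover b (T.map e) := by
    intro i
    obtain ⟨v, hv, hi⟩ := hT i
    exact ⟨e v, Finset.mem_map_of_mem e hv, hi⟩
  refine height_monomialIdeal_eq_iff.mpr ⟨?_, fun T hT => ?_⟩
  · have huniv : IsCover (restrictExps e b) Finset.univ := fun i => by
      obtain ⟨v, hv⟩ := Finsupp.ne_iff.mp (h0 i)
      exact ⟨v, Finset.mem_univ v, hv⟩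
    -- A minimal cover by the remaining variables is also minimal for `b`, so by unmixedness it is
    -- no larger than `U`. Without unmixedness the height could grow.
    obtain ⟨T, -, hT⟩ := exists_minimal_le_of_wellFoundedLT (IsCover (restrictExps e b)) _ huniv
    refine ⟨T, hT.1, ?_⟩
    refine le_trans ?_ hUc
    rw [← Finset.card_map e]
    refine (isCohenMacaulay_monomialQuotient_iff.mp h).card_le_card (hmap hT.1) ?_ hU
    intro T' hT'T hT'
    obtain ⟨S, hST, rfl⟩ := Finset.subset_map_iff.mp hT'T
    have hS : IsCover (restrictExps e b) S := by
      intro i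
      obtain ⟨v, hv, hi⟩ := hT' i
      obtain ⟨w, hw, rfl⟩ := Finset.mem_map.mp hv
      exact ⟨w, hw, hi⟩
    rw [Finset.Subset.antisymm hST (hT.2 hS hST)]
  · rw [← Finset.card_map e]
    exact hmin _ (hmap hT)

end Specialization

/-! ### Polarization. -/

section Polarization

lemma IsCohenMacaulayLocal.localization_of_quotient_span_singleton {A B : Type u} [CommRing A]
    [CommRing B] [IsNoetherianRing A] (f : A →+* B) (hf : Function.Surjective f) {t : A}
    (reg : ∀ x, t * x = 0 → x = 0) (hker : RingHom.ker f = Ideal.span {t}) (hB : IsCohenMacaulay B)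
    (Q : Ideal A) [Q.IsPrime] (ht : t ∈ Q) : IsCohenMacaulayLocal (Localization.AtPrime Q) := by
  have hle : RingHom.ker f ≤ Q := by rwa [hker, Ideal.span_singleton_le_iff_mem]
  have hp : (Q.map f).IsPrime := Ideal.map_isPrime_of_surjective hf hle
  have hQf : Q = (Q.map f).comap f := by
    rw [Ideal.comap_map_of_surjective' f hf, sup_eq_left.mpr hle]
  have ht' : IsSMulRegular A t := isSMulRegular_iff_right_eq_zero_of_smul.mpr reg
  exact IsCohenMacaulayLocal.localization_of_surjective f hf ht' hker (Q.map f) Q hQf (hB.2 _)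

lemma exists_quotient_hom_ker_eq {A B : Type u} [CommRing A] [CommRing B] (F : A →+* B)
    (hF : Function.Surjective F) {I : Ideal A} {J : Ideal B} (hIJ : I.map F = J) {t : A}
    (ht : RingHom.ker F = Ideal.span {t}) :
    ∃ f : A ⧸ I →+* B ⧸ J, Function.Surjective f ∧
      RingHom.ker f = Ideal.span {Ideal.Quotient.mk I t} := by
  refine ⟨Ideal.quotientMap J F (Ideal.map_le_iff_le_comap.mp hIJ.le),
    Ideal.quotientMap_surjective hF, le_antisymm ?_ ?_⟩
  · intro z hz
    obtain ⟨x, rfl⟩ := Ideal.Quotient.mk_surjective z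
    rw [RingHom.mem_ker, Ideal.quotientMap_mk, Ideal.Quotient.eq_zero_iff_mem, ← hIJ] at hz
    obtain ⟨y, hy, hyx⟩ := (Ideal.mem_map_iff_of_surjective _ hF).mp hz
    have h2 : x - y ∈ RingHom.ker F := by
      rw [RingHom.mem_ker, map_sub, hyx, sub_self]
    rw [ht] at h2
    have h3 := Ideal.mem_map_of_mem (Ideal.Quotient.mk I) h2
    rwa [Ideal.map_span, Set.image_singleton, map_sub, Ideal.Quotient.eq_zero_iff_mem.mpr hy,
      sub_zero] at h3
  · rw [Ideal.span_singleton_le_iff_mem, RingHom.mem_ker, Ideal.quotientMap_mk]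
    have h1 : F t = 0 := by
      rw [← RingHom.mem_ker, ht]
      exact Ideal.mem_span_singleton_self t
    rw [h1, map_zero]

variable (k : Type u) [Field k] {σ : Type} {ι : Type*}

open Classical in
/-- One step of polarization: one factor `x_q` is replaced by a new variable in those monomials
whose exponent of `x_q` is at least `j`. -/
noncomputable def polarize [Finite σ] (q : σ) (j : ℕ) (b : ι → σ →₀ ℕ) (i : ι) : Option σ →₀ ℕ :=
  Finsupp.equivFunOnFinite.symm fun o => o.elim (if j ≤ b i q then 1 else 0)
    fun a => b i a - if a = q ∧ j ≤ b i q then 1 else 0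

variable [Finite σ] {q : σ} {j : ℕ} {b : ι → σ →₀ ℕ}

open Classical in
lemma polarize_none (i : ι) : polarize q j b i none = if j ≤ b i q then 1 else 0 := rfl

open Classical in
lemma polarize_some (i : ι) (a : σ) :
    polarize q j b i (some a) = b i a - if a = q ∧ j ≤ b i q then 1 else 0 := rfl

lemma polarize_some_of_ne (i : ι) {a : σ} (ha : a ≠ q) : polarize q j b i (some a) = b i a := by
  simp [polarize_some, ha]

/-- Identify the new variable of the polarization with the old one. -/
noncomputable def depolarize (q : σ) : MvPolynomial (Option σ) k →ₐ[k] MvPolynomial σ k :=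
  MvPolynomial.rename fun o => o.getD q

omit [Finite σ] in
lemma depolarize_surjective (q : σ) : Function.Surjective (depolarize k q) :=
  MvPolynomial.rename_surjective _ fun a => ⟨some a, rfl⟩

lemma depolarize_monomial (hj : 1 ≤ j) (i : ι) :
    depolarize k q (MvPolynomial.monomial (polarize q j b i) 1) = MvPolynomial.monomial (b i) 1 := by
  classical
  have := Fintype.ofFinite σ
  rw [depolarize, MvPolynomial.rename_monomial]
  suffices h : Finsupp.mapDomain (fun o => o.getD q) (polarize q j b i) = b i by rw [h]
  ext a
  rw [Finsupp.mapDomain, Finsupp.sum_fintype _ _ (by simp), Finsupp.finsetSum_apply,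
    Fintype.sum_option, Finset.sum_eq_single a]
  · by_cases ha : a = q
    · subst ha
      simp only [polarize_none, polarize_some, Option.getD_none, Option.getD_some,
        Finsupp.single_eq_same, true_and]
      split_ifs <;> omega
    · simp [polarize_some_of_ne, ha]
  · intro x _ hx
    simp [hx]
  · simp

/-- The difference of the new and the old variable of the polarization. -/
noncomputable def polarizationElement (q : σ) : MvPolynomial (Option σ) k :=
  MvPolynomial.X none - MvPolynomial.X (some q)

omit [Finite σ] in
lemma ker_depolarize (q : σ) :
    RingHom.ker (depolarize k q) = Ideal.span {polarizationElement k q} := by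
  apply le_antisymm
  · intro x hx
    let I := Ideal.span {polarizationElement k q}
    have h : ((Ideal.Quotient.mkₐ k I).comp (MvPolynomial.rename some)).comp (depolarize k q) =
        Ideal.Quotient.mkₐ k I := by
      apply MvPolynomial.algHom_ext
      rintro (_ | a)
      · simp only [depolarize, AlgHom.comp_apply, MvPolynomial.rename_X, Option.getD_none,
          Ideal.Quotient.mkₐ_eq_mk]
        rw [eq_comm, Ideal.Quotient.mk_eq_mk_iff_sub_mem]
        exact Ideal.mem_span_singleton_self _
      · simp [depolarize]
    have h' := DFunLike.congr_fun h x
    rw [AlgHom.comp_apply, (RingHom.mem_ker).mp hx, map_zero, eq_comm, Ideal.Quotient.mkₐ_eq_mk,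
      Ideal.Quotient.eq_zero_iff_mem] at h'
    exact h'
  · rw [Ideal.span_singleton_le_iff_mem, RingHom.mem_ker]
    simp [depolarize, polarizationElement]

variable {k}

lemma mem_monomialIdeal_iff {σ : Type} {b : ι → σ →₀ ℕ} {x : MvPolynomial σ k} :
    x ∈ monomialIdeal k b ↔ ∀ m ∈ x.support, ∃ i, b i ≤ m := by
  have : monomialIdeal k b =
      Ideal.span ((fun s => MvPolynomial.monomial s (1 : k)) '' Set.range b) := by
    rw [monomialIdeal, ← Set.range_comp]
    rfl
  rw [this, MvPolynomial.mem_ideal_span_monomial_image]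
  simp

lemma lt_of_le_add_single_of_not_le {σ : Type} {m u : σ →₀ ℕ} {v : σ}
    (h : m ≤ u + Finsupp.single v 1) (h' : ¬ m ≤ u) : m v = u v + 1 ∧ ∀ w ≠ v, m w ≤ u w := by
  classical
  have h1 : ∀ w ≠ v, m w ≤ u w := fun w hw => by
    simpa [Finsupp.single_apply, Ne.symm hw] using h w
  refine ⟨?_, h1⟩
  have h2 := h v
  simp only [Finsupp.add_apply, Finsupp.single_eq_same] at h2
  by_contra hne
  refine h' fun w => ?_
  by_cases hw : w = v
  · subst hw; omega
  · exact h1 w hw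

/-- Let `y` be the new variable. Among the monomials of a representative that lie outside the ideal,
take `u` with the largest `y`-exponent. Comparing coefficients in the product with `y - x_q` shows
that both `u y` and `u x_q` lie in the ideal, and the two generators dividing them have incompatible
exponents of `x_q`. -/
lemma right_eq_zero_of_mul_polarizationElement {z : MonomialQuotient k (polarize q j b)}
    (hz : Ideal.Quotient.mk (monomialIdeal k (polarize q j b)) (polarizationElement k q) * z = 0) :
    z = 0 := by
  classical
  obtain ⟨x, rfl⟩ := Ideal.Quotient.mk_surjective z
  rw [← map_mul, Ideal.Quotient.eq_zero_iff_mem] at hz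
  rw [Ideal.Quotient.eq_zero_iff_mem]
  by_contra hx
  have hne : (x.support.filter fun m => ∀ i, ¬ polarize q j b i ≤ m).Nonempty := by
    rw [mem_monomialIdeal_iff] at hx
    push Not at hx
    obtain ⟨m, hm, h⟩ := hx
    exact ⟨m, Finset.mem_filter.mpr ⟨hm, h⟩⟩
  obtain ⟨u, hu, hmax⟩ := Finset.exists_max_image _ (fun m : Option σ →₀ ℕ => m none) hne
  obtain ⟨hux, huU⟩ := Finset.mem_filter.mp hu
  have hcoeff (m : Option σ →₀ ℕ) : (∃ i, polarize q j b i ≤ m) ∨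
      MvPolynomial.coeff m (polarizationElement k q * x) = 0 := by
    by_cases hm : m ∈ (polarizationElement k q * x).support
    · exact Or.inl (mem_monomialIdeal_iff.mp hz m hm)
    · exact Or.inr (MvPolynomial.notMem_support_iff.mp hm)
  have hne0 : MvPolynomial.coeff u x ≠ 0 := MvPolynomial.mem_support_iff.mp hux
  have hA : ∃ i, polarize q j b i ≤ u + Finsupp.single none 1 := by
    by_contra hno
    have h := (hcoeff _).resolve_left hno
    rw [polarizationElement, sub_mul, MvPolynomial.coeff_sub, add_comm,
      MvPolynomial.coeff_X_mul, MvPolynomial.coeff_X_mul'] at h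
    split_ifs at h with hq
    · set w := Finsupp.single none 1 + u - Finsupp.single (some q) 1 with hw
      have hwx : w ∈ x.support := by
        rw [MvPolynomial.mem_support_iff]
        intro h0
        rw [h0, sub_zero] at h
        exact hne0 h
      have hwn : w none = u none + 1 := by
        simp [hw, add_comm]
      by_cases hwU : ∀ i, ¬ polarize q j b i ≤ w
      · have := hmax w (Finset.mem_filter.mpr ⟨hwx, hwU⟩)
        omega
      -- By maximality of `u`, the monomial `w = u y / x_q` that could cancel the coefficient lies
      -- in the ideal, and then so does its multiple `u y`.
      · push Not at hwU
        obtain ⟨i, hi⟩ := hwU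
        exact hno ⟨i, hi.trans (by rw [hw, add_comm]; exact tsub_le_self)⟩
    · rw [sub_zero] at h
      exact hne0 h
  obtain ⟨i, hi⟩ := hA
  obtain ⟨h1, h2⟩ := lt_of_le_add_single_of_not_le hi (huU i)
  have h3 := h2 (some q) (by simp)
  rw [polarize_none] at h1
  rw [polarize_some] at h3
  have hB : ∃ i, polarize q j b i ≤ u + Finsupp.single (some q) 1 := by
    refine (hcoeff _).resolve_right fun h => ?_
    have hu0 : u none = 0 := by
      split_ifs at h1
      all_goals omega
    rw [polarizationElement, sub_mul, MvPolynomial.coeff_sub, add_comm,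
      MvPolynomial.coeff_X_mul, MvPolynomial.coeff_X_mul', if_neg (by simp [hu0]), zero_sub,
      neg_eq_zero] at h
    exact hne0 h
  obtain ⟨l, hl⟩ := hB
  obtain ⟨h4, h5⟩ := lt_of_le_add_single_of_not_le hl (huU l)
  have h6 := h5 none (by simp)
  rw [polarize_none] at h6
  rw [polarize_some] at h4
  -- Generator `i` involves `y` and generator `l` does not, so `b l q < j ≤ b i q`; but the
  -- exponents of `x_q` give `b i q ≤ u (some q) + 1 = b l q`.
  by_cases c1 : j ≤ b i q <;> by_cases c2 : j ≤ b l q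
  all_goals
    simp only [c1, c2, and_true, and_false, if_true, if_false] at h1 h3 h4 h6
    omega

/-- Polarization preserves the Cohen-Macaulay property. -/
lemma isCohenMacaulay_polarize (hj : 1 ≤ j) (h : IsCohenMacaulay (MonomialQuotient k b)) :
    IsCohenMacaulay (MonomialQuotient k (polarize q j b)) := by
  rw [isCohenMacaulay_monomialQuotient_iff]
  intro Q _ hQ
  have hmap : (monomialIdeal k (polarize q j b)).map (depolarize k q) = monomialIdeal k b := by
    rw [monomialIdeal, Ideal.map_span, ← Set.range_comp, monomialIdeal]
    congr 2
    ext1 i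
    exact depolarize_monomial k hj i
  obtain ⟨f, hf, hker⟩ := exists_quotient_hom_ker_eq (depolarize k q).toRingHom
    (depolarize_surjective k q) hmap (ker_depolarize k q)
  refine IsCohenMacaulayLocal.localization_of_quotient_span_singleton f hf
    (fun x hx => ?_) hker h Q ?_
  · exact right_eq_zero_of_mul_polarizationElement hx
  · rw [polarizationElement, map_sub]
    exact sub_mem (hQ none) (hQ (some q))

lemma height_monomialIdeal_polarize (hj : 1 ≤ j) {c : ℕ} (h : (monomialIdeal k b).height = c) :
    (monomialIdeal k (polarize q j b)).height = c := by
  classical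
  obtain ⟨⟨T, hT, hTc⟩, hmin⟩ := height_monomialIdeal_eq_iff.mp h
  refine height_monomialIdeal_eq_iff.mpr ⟨?_, fun U hU => ?_⟩
  · by_cases hq : q ∈ T ∧ j = 1
    · obtain ⟨hq, rfl⟩ := hq
      refine ⟨insert none ((T.erase q).map Function.Embedding.some), fun i => ?_, ?_⟩
      · obtain ⟨v, hv, hi⟩ := hT i
        by_cases hvq : v = q
        · subst hvq
          refine ⟨none, Finset.mem_insert_self _ _, ?_⟩
          simp [polarize_none, Nat.one_le_iff_ne_zero, hi]
        · refine ⟨some v, ?_, ?_⟩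
          · simp [hv, hvq]
          · rwa [polarize_some_of_ne _ hvq]
      · refine le_trans ?_ hTc
        refine (Finset.card_insert_le _ _).trans ?_
        rw [Finset.card_map, Finset.card_erase_add_one hq]
    · refine ⟨T.map Function.Embedding.some, fun i => ?_, by rwa [Finset.card_map]⟩
      obtain ⟨v, hv, hi⟩ := hT i
      refine ⟨some v, by simpa using hv, ?_⟩
      rw [polarize_some]
      split_ifs with hvq
      · obtain ⟨rfl, hle⟩ := hvq
        have : j ≠ 1 := fun h => hq ⟨hv, h⟩
        omega
      · simpa using hi
  · refine (hmin (U.image fun o => o.getD q) fun i => ?_).trans Finset.card_image_le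
    obtain ⟨v, hv, hi⟩ := hU i
    refine ⟨v.getD q, Finset.mem_image_of_mem _ hv, ?_⟩
    cases v with
    | none =>
      rw [polarize_none] at hi
      simp only [Option.getD_none]
      split_ifs at hi <;> omega
    | some a =>
      rw [polarize_some] at hi
      simp only [Option.getD_some]
      omega

end Polarization

end CommutativeAlgebra

/-! ### Disjoint unions, refinement and reduction of families. -/

namespace SetFamily

variable {α : Type*} {F G : Set (Set α)} {S : Set α}

lemma IsDisjointUnion.mono (h : IsDisjointUnion F S) (hFG : F ⊆ G) : IsDisjointUnion G S := by
  obtain ⟨H, hH, h⟩ := h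
  exact ⟨H, hH.trans hFG, h⟩

lemma isDisjointUnion_of_mem (h : S ∈ F) : IsDisjointUnion F S :=
  ⟨{S}, Set.singleton_subset_iff.mpr h, Set.pairwiseDisjoint_singleton _ _, Set.sUnion_singleton S⟩

lemma isDisjointUnion_empty (F : Set (Set α)) : IsDisjointUnion F ∅ :=
  ⟨∅, Set.empty_subset F, Set.pairwiseDisjoint_empty, Set.sUnion_empty⟩

lemma IsDisjointUnion.exists_mem_subset (h : IsDisjointUnion F S) {x : α} (hx : x ∈ S) :
    ∃ T ∈ F, x ∈ T ∧ T ⊆ S := by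
  obtain ⟨H, hH, -, rfl⟩ := h
  obtain ⟨T, hT, hxT⟩ := hx
  exact ⟨T, hH hT, hxT, Set.subset_sUnion_of_mem hT⟩

lemma IsDisjointUnion.of_refines (h : IsDisjointUnion G S) (hFG : Refines F G) :
    IsDisjointUnion F S := by
  obtain ⟨H, hH, hd, rfl⟩ := h
  choose! K hK hKd hKu using fun T (hT : T ∈ H) => hFG T (hH hT)
  refine ⟨⋃ T ∈ H, K T, Set.iUnion₂_subset hK, ?_, ?_⟩
  · intro A hA B hB hAB
    simp only [Set.mem_iUnion, exists_prop] at hA hB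
    obtain ⟨T, hT, hA⟩ := hA
    obtain ⟨U, hU, hB⟩ := hB
    by_cases hTU : T = U
    · subst hTU
      exact hKd T hT hA hB hAB
    · refine (hd hT hU hTU).mono ?_ ?_
      · exact (Set.subset_sUnion_of_mem hA).trans (hKu T hT).subset
      · exact (Set.subset_sUnion_of_mem hB).trans (hKu U hU).subset
  · simp only [Set.sUnion_iUnion, Set.sUnion_eq_biUnion (s := H)]
    exact Set.iUnion₂_congr hKu

lemma reduction_subset (F : Set (Set α)) : reduction F ⊆ F := fun _ h => h.1

/-- A discarded member is a disjoint union of strictly smaller members, so induction on cardinality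
applies. -/
lemma refines_reduction [Finite α] (F : Set (Set α)) : Refines (reduction F) F := by
  intro S
  induction hn : S.ncard using Nat.strong_induction_on generalizing S with
  | _ n ih =>
    intro hS
    by_cases h : IsDisjointUnion (F \ {S}) S
    · obtain ⟨H, hH, hd, hu⟩ := h
      refine IsDisjointUnion.of_refines (G := H) ⟨H, subset_rfl, hd, hu⟩ fun T hT => ?_
      have hTS : T ⊂ S := lt_of_le_of_ne (hu ▸ Set.subset_sUnion_of_mem hT) (hH hT).2
      exact ih _ (hn ▸ Set.ncard_lt_ncard hTS) T rfl (hH hT).1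
    · exact isDisjointUnion_of_mem ⟨hS, h⟩

lemma isReduced_reduction (F : Set (Set α)) : IsReduced (reduction F) :=
  (reduction_subset _).antisymm fun _ hS =>
    ⟨hS, fun h => hS.2 (h.mono (Set.sdiff_subset_sdiff_left (reduction_subset F)))⟩

lemma IsReduced.not_isDisjointUnion (hF : IsReduced F) (hS : S ∈ F) :
    ¬ IsDisjointUnion (F \ {S}) S :=
  (hF.symm.subset hS).2

lemma IsReduced.mem_of_isDisjointUnion (hG : IsReduced G) (hFG : F ⊆ G) (hS : S ∈ G)
    (h : IsDisjointUnion F S) : S ∈ F := by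
  by_contra hSF
  exact hG.not_isDisjointUnion hS (h.mono fun T hT => ⟨hFG hT, fun h => hSF (h ▸ hT)⟩)

end SetFamily

/-! ### Morphisms as matrices, refinements, and reduction of families of objects. -/

namespace MonomialTuple

variable {n : ℕ}

/-- The image of a generator under a morphism. -/
noncomputable abbrev Hom.gen {A B : MonomialTuple n} (f : A ⟶ B) (p : Fin A.r) : Fin B.r →₀ ℕ :=
  f.toAddMonoidHom (Finsupp.single p 1)

lemma addMonoidHom_apply {r s : ℕ} (f : (Fin r →₀ ℕ) →+ (Fin s →₀ ℕ)) (v : Fin r →₀ ℕ)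
    (q : Fin s) : f v q = ∑ p, v p * f (Finsupp.single p 1) q := by
  conv_lhs => rw [← Finsupp.univ_sum_single v]
  rw [map_sum, Finsupp.finsetSum_apply]
  refine Finset.sum_congr rfl fun p _ => ?_
  rw [← Finsupp.smul_single_one, map_nsmul, Finsupp.smul_apply, smul_eq_mul]

lemma Hom.exps_apply {A B : MonomialTuple n} (f : A ⟶ B) (i : Fin n) (q : Fin B.r) :
    B.exps i q = ∑ p, A.exps i p * Hom.gen f p q := by
  rw [← f.map_exps i, addMonoidHom_apply]

lemma Hom.mul_le_exps_apply {A B : MonomialTuple n} (f : A ⟶ B) (i : Fin n) (p : Fin A.r)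
    (q : Fin B.r) : A.exps i p * Hom.gen f p q ≤ B.exps i q := by
  rw [Hom.exps_apply f]
  exact Finset.single_le_sum (f := fun p => A.exps i p * Hom.gen f p q)
    (fun _ _ => Nat.zero_le _) (Finset.mem_univ p)

/-- The semigroup homomorphism with a given matrix. -/
noncomputable def matrixHom {r s : ℕ} (N : Fin s → Fin r → ℕ) : (Fin r →₀ ℕ) →+ (Fin s →₀ ℕ) where
  toFun v := Finsupp.equivFunOnFinite.symm fun q => ∑ p, v p * N q p
  map_zero' := by ext; simp
  map_add' v w := by ext; simp [add_mul, Finset.sum_add_distrib]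

lemma matrixHom_apply {r s : ℕ} (N : Fin s → Fin r → ℕ) (v : Fin r →₀ ℕ) (q : Fin s) :
    matrixHom N v q = ∑ p, v p * N q p := rfl

lemma matrixHom_single {r s : ℕ} (N : Fin s → Fin r → ℕ) (p : Fin r) (q : Fin s) :
    matrixHom N (Finsupp.single p 1) q = N q p := by
  rw [matrixHom_apply, Finset.sum_eq_single p] <;> simp +contextual [eq_comm]

/-- A disjoint union of members of the family of a square free tuple is cut out by a linear form. -/
lemma exists_sum_eq_of_isDisjointUnion {A : MonomialTuple n} (hA : ∀ i p, A.exps i p ≤ 1)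
    (hinj : Function.Injective A.varSet) {W : Set (Fin n)} [DecidablePred (· ∈ W)]
    (h : SetFamily.IsDisjointUnion A.family W) :
    ∃ N : Fin A.r → ℕ, ∀ i, ∑ p, A.exps i p * N p = if i ∈ W then 1 else 0 := by
  classical
  obtain ⟨H, hH, hd, hu⟩ := h
  refine ⟨fun p => if A.varSet p ∈ H then 1 else 0, fun i => ?_⟩
  beta_reduce
  split_ifs with hi
  · rw [← hu] at hi
    obtain ⟨T, hT, hiT⟩ := hi
    obtain ⟨p, rfl⟩ := hH hT
    rw [Finset.sum_eq_single p]
    · rw [if_pos hT, mul_one]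
      exact le_antisymm (hA i p) (Nat.one_le_iff_ne_zero.mpr hiT)
    · intro q _ hqp
      split_ifs with hq
      · rw [mul_one]
        by_contra hne
        exact Set.disjoint_left.mp (hd hq hT fun h => hqp (hinj h)) hne hiT
      · simp
    · simp
  · refine Finset.sum_eq_zero fun p _ => ?_
    split_ifs with hp
    · rw [mul_one]
      by_contra hne
      exact hi (hu ▸ ⟨_, hp, hne⟩)
    · simp

lemma exps_eq_ite {A : MonomialTuple n} (hA : ∀ i p, A.exps i p ≤ 1) (i : Fin n) (p : Fin A.r)
    [Decidable (i ∈ A.varSet p)] : A.exps i p = if i ∈ A.varSet p then 1 else 0 := by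
  have h := hA i p
  split_ifs with hi
  · exact le_antisymm h (Nat.one_le_iff_ne_zero.mpr hi)
  · exact not_not.mp hi

lemma nonempty_hom_of_refines {A B : MonomialTuple n} (hA : ∀ i p, A.exps i p ≤ 1)
    (hB : ∀ i p, B.exps i p ≤ 1) (hinj : Function.Injective B.varSet)
    (h : SetFamily.Refines B.family A.family) : Nonempty (B ⟶ A) := by
  classical
  choose N hN using fun p : Fin A.r =>
    exists_sum_eq_of_isDisjointUnion hB hinj (h _ (Set.mem_range_self p))
  refine ⟨⟨matrixHom N, fun i => ?_⟩⟩
  ext p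
  rw [matrixHom_apply, hN, exps_eq_ite hA]

lemma Hom.varSet_subset {A B : MonomialTuple n} (f : B ⟶ A) {q : Fin B.r} {p : Fin A.r}
    (h : Hom.gen f q p ≠ 0) : B.varSet q ⊆ A.varSet p := by
  intro i hi h0
  have := Hom.mul_le_exps_apply f i q p
  rw [h0, Nat.le_zero] at this
  exact mul_ne_zero hi h this

lemma Hom.exists_of_mem_varSet {A B : MonomialTuple n} (f : B ⟶ A) {p : Fin A.r} {i : Fin n}
    (h : i ∈ A.varSet p) : ∃ q, Hom.gen f q p ≠ 0 ∧ i ∈ B.varSet q := by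
  have h' : A.exps i p ≠ 0 := h
  rw [Hom.exps_apply f] at h'
  obtain ⟨q, -, hq⟩ := Finset.exists_ne_zero_of_sum_ne_zero h'
  exact ⟨q, right_ne_zero_of_mul hq, left_ne_zero_of_mul hq⟩

/-- An index in both sets would contribute at least two to an exponent of the square free tuple `A`.
-/
lemma Hom.disjoint_varSet {A B : MonomialTuple n} (f : B ⟶ A) (hA : ∀ i p, A.exps i p ≤ 1)
    {p : Fin A.r} {q q' : Fin B.r} (hq : Hom.gen f q p ≠ 0) (hq' : Hom.gen f q' p ≠ 0)
    (hne : q ≠ q') : Disjoint (B.varSet q) (B.varSet q') := by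
  classical
  rw [Set.disjoint_left]
  intro i hi hi'
  have h := hA i p
  rw [Hom.exps_apply f] at h
  have h2 := Finset.sum_le_sum_of_subset (f := fun q => B.exps i q * Hom.gen f q p)
    (Finset.subset_univ {q, q'})
  rw [Finset.sum_pair hne] at h2
  have h3 := Nat.one_le_iff_ne_zero.mpr (mul_ne_zero hi hq)
  have h4 := Nat.one_le_iff_ne_zero.mpr (mul_ne_zero hi' hq')
  omega

lemma Hom.isDisjointUnion {A B : MonomialTuple n} (f : B ⟶ A) (hA : ∀ i p, A.exps i p ≤ 1)
    (p : Fin A.r) :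
    SetFamily.IsDisjointUnion (B.varSet '' {q | Hom.gen f q p ≠ 0}) (A.varSet p) := by
  refine ⟨_, subset_rfl, ?_, ?_⟩
  · rintro _ ⟨q, hq, rfl⟩ _ ⟨q', hq', rfl⟩ hne
    exact Hom.disjoint_varSet f hA hq hq' fun h => hne (congrArg _ h)
  · apply subset_antisymm
    · rintro i ⟨_, ⟨q, hq, rfl⟩, hi⟩
      exact Hom.varSet_subset f hq hi
    · intro i hi
      obtain ⟨q, hq, hiq⟩ := Hom.exists_of_mem_varSet f hi
      exact ⟨_, ⟨q, hq, rfl⟩, hiq⟩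

lemma Hom.refines {A B : MonomialTuple n} (f : B ⟶ A) (hA : ∀ i p, A.exps i p ≤ 1) :
    SetFamily.Refines B.family A.family := by
  rintro _ ⟨p, rfl⟩
  exact (Hom.isDisjointUnion f hA p).mono (Set.image_subset_range _ _)

/-- The diagonal entry of the composite at `p` is one, so some `q` has nonzero entries in both
matrices; they give the two inclusions between `V_p` and `V_q`. -/
lemma Hom.family_subset_of_split {A B : MonomialTuple n} {f : B ⟶ A} {g : A ⟶ B}
    (h : g ≫ f = 𝟙 A) : A.family ⊆ B.family := by
  rintro _ ⟨p, rfl⟩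
  have h1 : f.toAddMonoidHom (Hom.gen g p) = Finsupp.single p 1 :=
    DFunLike.congr_fun (congrArg Hom.toAddMonoidHom h) (Finsupp.single p 1)
  have h2 := addMonoidHom_apply f.toAddMonoidHom (Hom.gen g p) p
  rw [h1, Finsupp.single_eq_same] at h2
  obtain ⟨q, -, hq⟩ := Finset.exists_ne_zero_of_sum_ne_zero (h2 ▸ one_ne_zero)
  exact ⟨q, subset_antisymm (Hom.varSet_subset f (right_ne_zero_of_mul hq))
    (Hom.varSet_subset g (left_ne_zero_of_mul hq))⟩

variable {k : Type u} [Field k] {c : ℕ}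

lemma exps_ne_zero {A : MonomialTuple n} (h : cm k n c A) (i : Fin n) : A.exps i ≠ 0 := by
  obtain ⟨⟨T, hT, -⟩, -⟩ := height_monomialIdeal_eq_iff.mp h.2
  obtain ⟨v, -, hv⟩ := hT i
  exact fun h0 => hv (by rw [h0]; rfl)

/-- Setting variables of an object of `CM(n,c)` equal to one gives an object of `CM(n,c)` if the
remaining exponents are nonzero and incomparable. -/
lemma exists_cm_restrictExps {σ τ : Type} [Finite σ] [Finite τ] (e : τ ↪ σ)
    {b : Fin n → σ →₀ ℕ} (hb : IsCohenMacaulay (MonomialQuotient k b))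
    (hc : (monomialIdeal k b).height = c) (h0 : ∀ i, restrictExps e b i ≠ 0)
    (hd : ∀ i j, i ≠ j → ¬ restrictExps e b i ≤ restrictExps e b j) :
    ∃ C : MonomialTuple n, cm k n c C ∧
      ∃ e' : Fin C.r ≃ τ, ∀ i p, C.exps i p = b i (e (e' p)) := by
  let e' := (Finite.equivFin τ).symm
  have hr (i j) (h : restrictExps (e'.toEmbedding.trans e) b i ≤
      restrictExps (e'.toEmbedding.trans e) b j) : restrictExps e b i ≤ restrictExps e b j := by
    intro t
    simpa using h (e'.symm t)
  refine ⟨⟨Nat.card τ, restrictExps (e'.toEmbedding.trans e) b,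
    fun i j hij h => hd i j hij (hr i j h)⟩, ⟨isCohenMacaulay_restrictExps rfl _ hb,
      height_monomialIdeal_restrictExps _ hb hc fun i hi => h0 i ?_⟩, e', fun i p => rfl⟩
  ext t
  simpa using DFunLike.congr_fun hi (e'.symm t)

/-- Keep one variable for each member of the reduction and set the rest to one; the choice also
removes repeated sets. Each index in `V_p` lies in a kept set inside `V_p`, so exponents stay
nonzero and any divisibility would lift to `C`. -/
lemma isAssociatedFamily_reduction {C : MonomialTuple n} (hC : cm k n c C)
    (hsq : ∀ i p, C.exps i p ≤ 1) : IsAssociatedFamily k n c (SetFamily.reduction C.family) := by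
  choose e he using fun S : SetFamily.reduction C.family => SetFamily.reduction_subset _ S.2
  have hinj : Function.Injective e := fun S T h => Subtype.ext (by rw [← he, ← he, h])
  have key (i p) (hi : C.exps i p ≠ 0) : ∃ S, C.exps i (e S) ≠ 0 ∧ (S : Set _) ⊆ C.varSet p := by
    obtain ⟨S, hS, hiS, hSp⟩ := (SetFamily.refines_reduction C.family _
      (Set.mem_range_self p)).exists_mem_subset hi
    exact ⟨⟨S, hS⟩, (he ⟨S, hS⟩).symm.subset hiS, hSp⟩
  obtain ⟨D, hD, e', hDe⟩ := exists_cm_restrictExps ⟨e, hinj⟩ hC.1 hC.2 (fun i hi => by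
    obtain ⟨p, hp⟩ := Finsupp.ne_iff.mp (exps_ne_zero hC i)
    obtain ⟨S, hS, -⟩ := key i p hp
    exact hS (DFunLike.congr_fun hi S)) (fun i j hij h => C.not_dvd i j hij fun p => by
    by_cases hp : C.exps i p = 0
    · simp [hp]
    · obtain ⟨S, hS, hSp⟩ := key i p hp
      have hj : C.exps j (e S) ≠ 0 := fun h0 => hS (Nat.le_zero.mp (h0 ▸ h S))
      exact (hsq i p).trans (Nat.one_le_iff_ne_zero.mpr (hSp ((he S).subset hj))))
  have hV (p) : D.varSet p = (e' p : Set _) := by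
    rw [← he]
    ext i
    exact not_congr (by rw [hDe]; rfl)
  refine ⟨D, ⟨hD, fun i p => (hDe i p).trans_le (hsq i _), fun p q h => ?_⟩, ?_⟩
  · rw [hV, hV] at h
    exact e'.injective (Subtype.ext h)
  · ext S
    constructor
    · rintro ⟨p, rfl⟩
      rw [hV]
      exact (e' p).2
    · intro hS
      exact ⟨e'.symm ⟨S, hS⟩, by rw [hV, Equiv.apply_symm_apply]⟩

end MonomialTuple

/-! ### Splitting arbitrary morphisms to an object with maximal reduced family. -/

namespace MonomialTuple

variable {n : ℕ} {k : Type u} [Field k] {c : ℕ}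

/-- The map to `A` makes the restricted tuple admissible: additive maps preserve zero and
divisibility, so a zero or comparable exponent would show up in `A`. -/
lemma exists_cm_hom_of_restrictExps {σ τ : Type} [Finite σ] [Finite τ] (e : τ ↪ σ)
    {b : Fin n → σ →₀ ℕ} (hb : IsCohenMacaulay (MonomialQuotient k b))
    (hc : (monomialIdeal k b).height = c) {A : MonomialTuple n} (hA : cm k n c A)
    (f : (τ →₀ ℕ) →+ (Fin A.r →₀ ℕ)) (hf : ∀ i, f (restrictExps e b i) = A.exps i) :
    ∃ C : MonomialTuple n, cm k n c C ∧ Nonempty (C ⟶ A) ∧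
      ∃ e' : Fin C.r ≃ τ, ∀ i p, C.exps i p = b i (e (e' p)) := by
  obtain ⟨C, hC, e', he'⟩ := exists_cm_restrictExps e hb hc
    (fun i hi => exps_ne_zero hA i (by rw [← hf, hi, map_zero])) (fun i j hij h => by
      obtain ⟨d, hd⟩ := exists_add_of_le h
      exact A.not_dvd i j hij (by rw [← hf, ← hf j, hd, map_add]; exact le_self_add))
  refine ⟨C, hC, ⟨⟨f.comp (Finsupp.domCongr e').toAddMonoidHom, fun i => ?_⟩⟩, e', he'⟩
  have h : Finsupp.domCongr e' (C.exps i) = restrictExps e b i := by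
    ext t
    simp [Finsupp.equivMapDomain_apply, he']
  exact (congrArg f h).trans (hf i)

lemma Hom.map_mapDomain_restrictExps {A B : MonomialTuple n} (f : B ⟶ A) (i : Fin n) :
    f.toAddMonoidHom (Finsupp.mapDomain Subtype.val (restrictExps
      (Function.Embedding.subtype fun q => Hom.gen f q ≠ 0) B.exps i)) = A.exps i := by
  ext p
  rw [addMonoidHom_apply, Hom.exps_apply f]
  refine Finset.sum_congr rfl fun q _ => ?_
  by_cases hq : Hom.gen f q = 0
  · rw [Hom.gen] at hq
    simp [hq]
  · congr 1
    exact Finsupp.mapDomain_apply Subtype.val_injective _ (⟨q, hq⟩ : {q // Hom.gen f q ≠ 0})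

lemma Hom.exps_le_one_of_gen_ne_zero {A B : MonomialTuple n} (f : B ⟶ A)
    (hA : ∀ i p, A.exps i p ≤ 1) {q : Fin B.r} (hq : Hom.gen f q ≠ 0) (i : Fin n) :
    B.exps i q ≤ 1 := by
  obtain ⟨p, hp⟩ := Finsupp.ne_iff.mp hq
  exact (Nat.le_mul_of_pos_right _ (Nat.pos_of_ne_zero hp)).trans
    ((Hom.mul_le_exps_apply f i q p).trans (hA i p))

lemma varSet_nonempty {A : MonomialTuple n} (hred : SetFamily.IsReduced A.family) (p : Fin A.r) :
    (A.varSet p).Nonempty := by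
  rw [Set.nonempty_iff_ne_empty]
  intro h
  refine hred.not_isDisjointUnion (Set.mem_range_self p) ?_
  rw [h]
  exact SetFamily.isDisjointUnion_empty _

section Splitting

variable {A : MonomialTuple n} (hA : cmStar k n c A)
  (hmax : ∀ C : MonomialTuple n, cm k n c C → (∀ i p, C.exps i p ≤ 1) → (C ⟶ A) →
    SetFamily.Refines A.family C.family)
  {B : MonomialTuple n} (hB : cm k n c B) (f : B ⟶ A)

include hA hmax hB

/-- Setting the variables killed by `f` to one leaves a square free object over `A`, to which `hmax`
applies. -/
lemma isDisjointUnion_varSet {q : Fin B.r} (hq : Hom.gen f q ≠ 0) :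
    SetFamily.IsDisjointUnion A.family (B.varSet q) := by
  obtain ⟨C, hC, ⟨g⟩, e', he'⟩ := exists_cm_hom_of_restrictExps
    (Function.Embedding.subtype fun q => Hom.gen f q ≠ 0) hB.1 hB.2 hA.1
    (f.toAddMonoidHom.comp (Finsupp.mapDomain.addMonoidHom Subtype.val))
    (Hom.map_mapDomain_restrictExps f)
  have h := hmax C hC (fun i p => (he' i p).trans_le
    (Hom.exps_le_one_of_gen_ne_zero f hA.2.1 (e' p).2 i)) g _ (Set.mem_range_self (e'.symm ⟨q, hq⟩))
  convert h using 1
  ext i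
  exact not_congr (by rw [he', Equiv.apply_symm_apply]; rfl)

/-- Polarize at `q` in level `j`, then keep only the new variable and those not killed by `f`. The
result is square free and maps to `A` by sending the new variable to zero; the set of that variable
is the level set. -/
lemma isDisjointUnion_setOf_le {q : Fin B.r} (hq : Hom.gen f q = 0) {j : ℕ} (hj : 1 ≤ j) :
    SetFamily.IsDisjointUnion A.family {i | j ≤ B.exps i q} := by
  obtain ⟨C, hC, ⟨g⟩, e', he'⟩ := exists_cm_hom_of_restrictExps
    (Function.Embedding.subtype fun q => Hom.gen f q ≠ 0).optionMap
    (isCohenMacaulay_polarize (q := q) hj hB.1) (height_monomialIdeal_polarize hj hB.2) hA.1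
    ((f.toAddMonoidHom.comp (Finsupp.mapDomain.addMonoidHom Subtype.val)).comp
      (Finsupp.comapDomain.addMonoidHom (Option.some_injective _))) (fun i => by
      rw [← Hom.map_mapDomain_restrictExps f i]
      refine congrArg (fun v => f.toAddMonoidHom (Finsupp.mapDomain Subtype.val v)) ?_
      ext t
      exact polarize_some_of_ne i fun h => t.2 ((congrArg (Hom.gen f) h).trans hq))
  have hsq : ∀ i p, C.exps i p ≤ 1 := by
    intro i p
    rw [he']
    rcases e' p with _ | t
    · change polarize q j B.exps i none ≤ 1
      rw [polarize_none]
      split_ifs <;> omega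
    · refine (polarize_some_of_ne i fun h => t.2 ((congrArg (Hom.gen f) h).trans hq)).trans_le ?_
      exact Hom.exps_le_one_of_gen_ne_zero f hA.2.1 t.2 i
  convert hmax C hC hsq g _ (Set.mem_range_self (e'.symm none)) using 1
  ext i
  change j ≤ B.exps i q ↔ C.exps i _ ≠ 0
  rw [he', Equiv.apply_symm_apply]
  change _ ↔ polarize q j B.exps i none ≠ 0
  rw [polarize_none]
  split_ifs with h <;> simp [h]

lemma exists_sum_eq_exps_of_gen_eq_zero {q : Fin B.r} (hq : Hom.gen f q = 0) :
    ∃ N : Fin A.r → ℕ, ∀ i, ∑ p, A.exps i p * N p = B.exps i q := by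
  classical
  choose! N hN using fun (j : ℕ) (hj : 1 ≤ j) => exists_sum_eq_of_isDisjointUnion hA.2.1 hA.2.2
    (isDisjointUnion_setOf_le hA hmax hB f hq hj)
  -- Any common bound for the exponents of `q` would do. The number of levels `j` in `[1, M]` with
  -- `j ≤ b_i(q)` is `b_i(q)`, so the forms of the levels add up to the exponent.
  let M := ∑ i, B.exps i q
  refine ⟨fun p => ∑ j ∈ Finset.Icc 1 M, N j p, fun i => ?_⟩
  have hM : B.exps i q ≤ M :=
    Finset.single_le_sum (f := fun i => B.exps i q) (fun _ _ => Nat.zero_le _) (Finset.mem_univ i)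
  simp only [Finset.mul_sum]
  rw [Finset.sum_comm, Finset.sum_congr rfl fun j hj => hN j (Finset.mem_Icc.mp hj).1 i,
    ← Finset.card_filter]
  have : (Finset.Icc 1 M).filter (fun j => i ∈ {i | j ≤ B.exps i q}) =
      Finset.Icc 1 (B.exps i q) := by
    ext j
    simp only [Finset.mem_filter, Finset.mem_Icc, Set.mem_ofPred_eq]
    omega
  rw [this, Nat.card_Icc, Nat.add_sub_cancel]

variable (hred : SetFamily.IsReduced A.family)

include hred

/-- Each variable of `A` comes from a unique relevant variable of `B`. -/
lemma exists_varSet_eq (p : Fin A.r) : ∃ q, Hom.gen f q p ≠ 0 ∧ B.varSet q = A.varSet p ∧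
    ∀ q', q' ≠ q → Hom.gen f q' p ≠ 0 → B.varSet q' = ∅ := by
  -- Otherwise the pieces of `V_p` would all decompose into members of the family other than `V_p`,
  -- against reducedness.
  have key : ∃ q, Hom.gen f q p ≠ 0 ∧ B.varSet q = A.varSet p := by
    by_contra! hno
    refine hred.not_isDisjointUnion (Set.mem_range_self p)
      ((Hom.isDisjointUnion f hA.2.1 p).of_refines ?_)
    rintro _ ⟨q, hq, rfl⟩
    have hq' : Hom.gen f q p ≠ 0 := hq
    obtain ⟨H, hH, hd, hu⟩ := isDisjointUnion_varSet hA hmax hB f (q := q)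
      (fun h => hq (by rw [h]; rfl))
    refine ⟨H, fun T hT => ⟨hH hT, ?_⟩, hd, hu⟩
    rintro rfl
    exact hno q hq (subset_antisymm (Hom.varSet_subset f hq)
      (hu ▸ Set.subset_sUnion_of_mem hT))
  obtain ⟨q, hq, hqp⟩ := key
  refine ⟨q, hq, hqp, fun q' hne hq' => ?_⟩
  have h := Hom.disjoint_varSet f hA.2.1 hq hq' hne.symm
  rw [hqp] at h
  exact Set.subset_eq_empty (h (Hom.varSet_subset f hq') subset_rfl) rfl

/-- Choose `θ p` over `p`; then `f` sends the generator `θ p` to `p`. The rows of `g` at variables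
not killed by `f` are the indicators of `θ p = q`, and the rows at killed variables, needed only to
hit the exponents of `B`, do not affect the composite. -/
lemma exists_splitting : ∃ g : A ⟶ B, g ≫ f = 𝟙 A := by
  classical
  choose θ hθ hθV hθu using exists_varSet_eq hA hmax hB f hred
  have hne := varSet_nonempty hred
  have hgen (p) : Hom.gen f (θ p) = Finsupp.single p 1 := by
    ext p'
    by_cases hp : p = p'
    · subst hp
      rw [Finsupp.single_eq_same]
      obtain ⟨i, hi⟩ := hne p
      have h1 := (Hom.mul_le_exps_apply f i (θ p) p).trans (hA.2.1 i p)
      have h2 : B.exps i (θ p) ≠ 0 := (hθV p).symm.subset hi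
      refine le_antisymm ((Nat.le_mul_of_pos_left _ (Nat.pos_of_ne_zero h2)).trans h1) ?_
      exact Nat.one_le_iff_ne_zero.mpr (hθ p)
    · rw [Finsupp.single_eq_of_ne (Ne.symm hp)]
      by_contra h0
      have h1 : θ p = θ p' := by
        by_contra h
        have := hθu p' (θ p) h h0
        rw [hθV] at this
        exact (hne p).ne_empty this
      refine hp (hA.2.2 ?_)
      rw [← hθV, h1, hθV]
  have hinj : Function.Injective θ := fun p p' h =>
    Finsupp.single_left_injective one_ne_zero ((hgen p).symm.trans (h ▸ hgen p'))
  have hex (q : Fin B.r) : ∃ N : Fin A.r → ℕ, (∀ i, ∑ p, A.exps i p * N p = B.exps i q) ∧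
      (Hom.gen f q ≠ 0 → ∀ p, N p = if θ p = q then 1 else 0) := by
    by_cases hq : Hom.gen f q = 0
    · obtain ⟨N, hN⟩ := exists_sum_eq_exps_of_gen_eq_zero hA hmax hB f hq
      exact ⟨N, hN, fun h => absurd hq h⟩
    · refine ⟨fun p => if θ p = q then 1 else 0, fun i => ?_, fun _ _ => rfl⟩
      by_cases hqr : ∃ p, θ p = q
      · obtain ⟨p, rfl⟩ := hqr
        rw [Finset.sum_eq_single p]
        · have h1 := hA.2.1 i p
          have h2 := Hom.exps_le_one_of_gen_ne_zero f hA.2.1 hq i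
          have h3 : B.exps i (θ p) ≠ 0 ↔ A.exps i p ≠ 0 := Set.ext_iff.mp (hθV p) i
          simp only [if_true, mul_one]
          omega
        · intro p' _ hp'
          simp [hinj.ne hp']
        · simp
      -- A variable that is neither killed nor some `θ p` has empty set, so its row is zero.
      · push Not at hqr
        obtain ⟨p, hp⟩ := Finsupp.ne_iff.mp hq
        have h0 : i ∉ B.varSet q := by
          rw [hθu p q (hqr p).symm hp]
          exact Set.notMem_empty i
        rw [show B.exps i q = 0 from not_not.mp h0]
        simp [hqr]
  choose N hN hNθ using hex
  refine ⟨⟨matrixHom N, fun i => ?_⟩, ?_⟩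
  · ext q
    rw [matrixHom_apply, hN]
  · apply Hom.ext
    apply Finsupp.addHom_ext'
    intro p
    apply AddMonoidHom.ext_nat
    change f.toAddMonoidHom (matrixHom N (Finsupp.single p 1)) = Finsupp.single p 1
    ext p'
    rw [addMonoidHom_apply, Finset.sum_eq_single (θ p)]
    · change _ * Hom.gen f (θ p) p' = _
      rw [hgen, matrixHom_single, hNθ (θ p) (by rw [hgen]; simp) p, if_pos rfl, one_mul]
    · intro q _ hq
      rw [matrixHom_single]
      by_cases h0 : Hom.gen f q = 0
      · rw [Hom.gen] at h0
        simp [h0]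
      · rw [hNθ q h0, if_neg (Ne.symm hq), zero_mul]
    · simp

end Splitting

lemma surjective_of_split {A B : MonomialTuple n} {f : B ⟶ A} {g : A ⟶ B} (h : g ≫ f = 𝟙 A) :
    Function.Surjective f.toAddMonoidHom := fun v =>
  ⟨g.toAddMonoidHom v, DFunLike.congr_fun (congrArg Hom.toAddMonoidHom h) v⟩

end MonomialTuple

theorem proposition1p7 (k : Type u) [Field k] (n c : ℕ) :
    (∀ F : Set (Set (Fin n)), IsAssociatedFamily k n c F →
      IsAssociatedFamily k n c (SetFamily.reduction F)) ∧
    (∀ A : MonomialTuple n, MonomialTuple.cmStar k n c A →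
      (A.IsMaximalObject k c ↔
        SetFamily.IsReduced A.family ∧
        ∀ G : Set (Set (Fin n)), IsAssociatedFamily k n c G → SetFamily.IsReduced G →
          SetFamily.Refines G A.family → G = A.family)) := by
  have ha : ∀ F : Set (Set (Fin n)), IsAssociatedFamily k n c F →
      IsAssociatedFamily k n c (SetFamily.reduction F) := by
    rintro _ ⟨A, hA, rfl⟩
    exact MonomialTuple.isAssociatedFamily_reduction hA.1 hA.2.1
  refine ⟨ha, fun A hA => ⟨fun hmax => ?_, fun ⟨hred, hmax⟩ => ?_⟩⟩
  · have key : ∀ B : MonomialTuple n, MonomialTuple.cmStar k n c B →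
      SetFamily.Refines B.family A.family →
        A.family ⊆ B.family ∧ SetFamily.Refines A.family B.family := by
      intro B hB h
      obtain ⟨f⟩ := MonomialTuple.nonempty_hom_of_refines hA.2.1 hB.2.1 hB.2.2 h
      obtain ⟨-, g, hg⟩ := hmax.2 B hB.1 f
      exact ⟨MonomialTuple.Hom.family_subset_of_split hg, MonomialTuple.Hom.refines g hB.2.1⟩
    constructor
    · obtain ⟨B, hB, hBF⟩ := ha _ ⟨A, hA, rfl⟩
      -- The reduction refines the family and comes from an object, so `key` places the whole family
      -- inside its reduction.
      refine (SetFamily.reduction_subset _).antisymm ?_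
      rw [← hBF]
      exact (key B hB (hBF ▸ SetFamily.refines_reduction _)).1
    · rintro _ ⟨B, hB, rfl⟩ hG hGF
      obtain ⟨h1, h2⟩ := key B hB hGF
      exact Set.Subset.antisymm (fun S hS => hG.mem_of_isDisjointUnion h1 hS (h2 S hS)) h1
  · refine ⟨hA.1, fun B hB f => ?_⟩
    -- The reduction of the family of `C` is reduced and refines that of `A`, so it equals it by
    -- maximality; and it refines the family of `C`.
    obtain ⟨g, hg⟩ := MonomialTuple.exists_splitting hA (fun C hC hsq φ => by
      have h := SetFamily.refines_reduction C.family
      rwa [hmax _ (MonomialTuple.isAssociatedFamily_reduction hC hsq)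
        (SetFamily.isReduced_reduction _)
        fun S hS => (MonomialTuple.Hom.refines φ hA.2.1 S hS).of_refines h] at h) hB f hred
    exact ⟨MonomialTuple.surjective_of_split hg, g, hg⟩
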